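/- For an integer $X\ge 0$ let $m=m_X=\prod_{l\le X,\ l\ \text{prime}} l$, let $\zeta_m$ be a primitive $m$-th root of unity, $K=\mathbb Q(\zeta_m)$ with ring of integers $\mathcal O_K=\mathbb Z[\zeta_m]$, and let $\phi$ be Euler's function. Equip $K_{\mathbb R}=K\otimes_{\mathbb Q}\mathbb R$ with the scalar product $\langle x,y\rangle=\operatorname{tr}(x\bar y)$ and $E=K_{\mathbb R}^2$ with $\langle x,y\rangle=\langle x_1,y_1\rangle+\langle x_2,y_2\rangle$, so that $E$ is a Euclidean space of dimension $n=2\phi(m)$. For a prime ideal $\mathfrak P$ of $\mathcal O_K$ lying over a prime number that does not divide $m$, put $F=\mathcal O_K/\mathfrak P$; for an $F$-line (one-dimensional subspace) $C\subset F^2$ let $\Lambda_C\subset E$ be the preimage of $C$ under the coordinatewise reduction $\mathcal O_K^2\to F^2$, and let $\mathcal L_{\mathcal C}=\mathcal L_{\mathcal C}(\mathfrak P)$ be the set of the lattices $\Lambda_C$, $C$ running over the $F$-lines of $F^2$. The density of a lattice $\Lambda\subset E$ is $\Delta(\Lambda)=\operatorname{Vol}(B(\mu))/(2^n\operatorname{Vol}(\Lambda))$,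 where $\mu$ is the minimum norm of the nonzero vectors of $\Lambda$, $B(\mu)$ is the closed ball of radius $\mu$, and $\operatorname{Vol}(\Lambda)$ is the volume of a fundamental region of $\Lambda$. Choose for every integer $X\ge 0$ a prime ideal $\mathfrak P_X$ of $\mathbb Z[\zeta_{m_X}]$ lying over a prime number that does not divide $m_X$, in such a way that, with $q_X=|\mathbb Z[\zeta_{m_X}]/\mathfrak P_X|$, $$\phi(m_X)^2\,m_X=o\big(q_X^{1/\phi(m_X)}\big)\qquad (X\to\infty).$$ Such choices exist, and for every such choice and all sufficiently large $X$ the family $\mathcal L_{\mathcal C}(\mathfrak P_X)$ contains a lattice $\Lambda\subset E\cong\mathbb R^n$, $n=2\phi(m_X)$, with $$\Delta(\Lambda)\ \ge\ \frac{0.89\,n\log\log n}{2^n}.$$ In particular this holds for infinitely many dimensions $n$. -/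

import Mathlib

open Filter Topology MeasureTheory Asymptotics NumberField
open scoped TensorProduct ComplexConjugate

noncomputable section

/-! ### Lattices in Euclidean spaces -/

section Lattices

variable {E : Type*} [NormedAddCommGroup E] [InnerProductSpace ℝ E]

/-- A lattice of `E`: a discrete subgroup that spans `E` over `ℝ`. -/
def IsEuclideanLattice (L : Submodule ℤ E) : Prop :=
  DiscreteTopology L ∧ Submodule.span ℝ (L : Set E) = ⊤

/-- The minimum of a lattice: the least norm of a nonzero vector. -/
def latticeMinimum (L : Submodule ℤ E) : ℝ :=
  sInf {r : ℝ | ∃ x ∈ L, x ≠ 0 ∧ r = ‖x‖}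

/-- The density of the sphere packing of a lattice `L` in a Euclidean space `E` of dimension `n`,
that is `Vol (B (μ)) / (2 ^ n * Vol (L))`, where `μ` is the minimum of `L`, the measure is the
Lebesgue measure of the Euclidean space `E`, and `Vol (L)` is the volume of a fundamental
region of `L`. -/
def latticeDensity [FiniteDimensional ℝ E] [MeasurableSpace E] [BorelSpace E]
    (L : Submodule ℤ E) : ℝ :=
  (volume : Measure E).real (Metric.closedBall 0 (latticeMinimum L)) /
    (2 ^ Module.finrank ℝ E * ZLattice.covolume L volume)

end Lattices

/-! ### The Euclidean space attached to a cyclotomic field -/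

section Cyclotomic

variable (m : ℕ) [NeZero m]

instance cyclotomicField_isCyclotomicExtension :
    IsCyclotomicExtension {m} ℚ (CyclotomicField m ℚ) := by
  have h : (DivisionRing.toRatAlgebra : Algebra ℚ (CyclotomicField m ℚ)) =
    CyclotomicField.algebra m ℚ := Subsingleton.elim _ _
  rw [h]
  exact CyclotomicField.isCyclotomicExtension m ℚ

/-- Complex conjugation of `ℚ(ζ_m)`: the automorphism that sends `ζ_m` to `ζ_m⁻¹`. -/
def cyclotomicConj : CyclotomicField m ℚ ≃ₐ[ℚ] CyclotomicField m ℚ :=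
  IsCyclotomicExtension.fromZetaAut
    (IsCyclotomicExtension.zeta_spec m ℚ (CyclotomicField m ℚ)).inv
    (Polynomial.cyclotomic.irreducible_rat (NeZero.pos m))

theorem cyclotomicConj_zeta :
    cyclotomicConj m (IsCyclotomicExtension.zeta m ℚ (CyclotomicField m ℚ)) =
      (IsCyclotomicExtension.zeta m ℚ (CyclotomicField m ℚ))⁻¹ :=
  IsCyclotomicExtension.fromZetaAut_spec _ _

theorem embedding_cyclotomicConj (φ : CyclotomicField m ℚ →+* ℂ) (x : CyclotomicField m ℚ) :
    φ (cyclotomicConj m x) = conj (φ x) := by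
  have hζ := IsCyclotomicExtension.zeta_spec m ℚ (CyclotomicField m ℚ)
  have key : (φ.toRatAlgHom.comp (cyclotomicConj m : _ →ₐ[ℚ] _)) =
      ((starRingEnd ℂ).comp φ).toRatAlgHom := by
    apply (hζ.powerBasis ℚ).algHom_ext
    have h1 : φ (IsCyclotomicExtension.zeta m ℚ (CyclotomicField m ℚ)) ^ m = 1 := by
      rw [← map_pow, hζ.pow_eq_one, map_one]
    have h2 := Complex.norm_eq_one_of_pow_eq_one h1 (NeZero.ne m)
    simpa [cyclotomicConj_zeta] using Complex.inv_eq_conj h2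
  exact DFunLike.congr_fun key x

/-- The real algebra `ℚ(ζ_m) ⊗ ℝ`. -/
def CyclotomicRealSpace : Type := ℝ ⊗[ℚ] CyclotomicField m ℚ

namespace CyclotomicRealSpace

instance : CommRing (CyclotomicRealSpace m) :=
  inferInstanceAs (CommRing (ℝ ⊗[ℚ] CyclotomicField m ℚ))

instance : Algebra ℝ (CyclotomicRealSpace m) :=
  inferInstanceAs (Algebra ℝ (ℝ ⊗[ℚ] CyclotomicField m ℚ))

instance : Module.Finite ℝ (CyclotomicRealSpace m) :=
  inferInstanceAs (Module.Finite ℝ (ℝ ⊗[ℚ] CyclotomicField m ℚ))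

/-- The natural embedding of `ℚ(ζ_m)` into `ℚ(ζ_m) ⊗ ℝ`. -/
def of : CyclotomicField m ℚ →+* CyclotomicRealSpace m :=
  (Algebra.TensorProduct.includeRight :
    CyclotomicField m ℚ →ₐ[ℚ] ℝ ⊗[ℚ] CyclotomicField m ℚ).toRingHom

/-- Complex conjugation, extended `ℝ`-linearly to `ℚ(ζ_m) ⊗ ℝ`. -/
def conjugate : CyclotomicRealSpace m →ₐ[ℝ] CyclotomicRealSpace m :=
  (Algebra.TensorProduct.map (AlgHom.id ℝ ℝ) (cyclotomicConj m : _ →ₐ[ℚ] _) :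
    ℝ ⊗[ℚ] CyclotomicField m ℚ →ₐ[ℝ] ℝ ⊗[ℚ] CyclotomicField m ℚ)

/-- The trace form `tr (x * conj y)` on `ℚ(ζ_m) ⊗ ℝ`. -/
def traceForm (x y : CyclotomicRealSpace m) : ℝ :=
  Algebra.trace ℝ (CyclotomicRealSpace m) (x * conjugate m y)

/-- The `ℝ`-linear extension of a complex embedding of `ℚ(ζ_m)`. -/
def extendEmbedding (φ : CyclotomicField m ℚ →+* ℂ) : CyclotomicRealSpace m →ₐ[ℝ] ℂ :=
  (Algebra.TensorProduct.lift (Algebra.ofId ℝ ℂ) φ.toRatAlgHom (fun _ _ => Commute.all _ _) :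
    ℝ ⊗[ℚ] CyclotomicField m ℚ →ₐ[ℝ] ℂ)

theorem extendEmbedding_tmul (φ : CyclotomicField m ℚ →+* ℂ) (r : ℝ) (k : CyclotomicField m ℚ) :
    extendEmbedding m φ (r ⊗ₜ[ℚ] k : ℝ ⊗[ℚ] CyclotomicField m ℚ) = r * φ k := by
  erw [Algebra.TensorProduct.lift_tmul]
  rfl

theorem extendEmbedding_conjugate (φ : CyclotomicField m ℚ →+* ℂ) (x : CyclotomicRealSpace m) :
    extendEmbedding m φ (conjugate m x) = conj (extendEmbedding m φ x) := by
  refine TensorProduct.induction_on (motive := fun z : ℝ ⊗[ℚ] CyclotomicField m ℚ =>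
    extendEmbedding m φ (conjugate m z) = conj (extendEmbedding m φ z)) x ?_ ?_ ?_
  · exact (map_zero ((extendEmbedding m φ).comp (conjugate m))).trans
      (by erw [map_zero (extendEmbedding m φ)]; simp)
  · intro r k
    have h : conjugate m (r ⊗ₜ[ℚ] k : ℝ ⊗[ℚ] CyclotomicField m ℚ) =
      (r ⊗ₜ[ℚ] cyclotomicConj m k : ℝ ⊗[ℚ] CyclotomicField m ℚ) := rfl
    rw [h, extendEmbedding_tmul, extendEmbedding_tmul, embedding_cyclotomicConj]
    simp
  · intro a b ha hb
    have h1 := map_add (extendEmbedding m φ) a b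
    have h2 := map_add (conjugate m) a b
    erw [h2, map_add, h1, map_add, ha, hb]
    rfl

theorem trace_tmul (r : ℝ) (k : CyclotomicField m ℚ) :
    Algebra.trace ℝ (CyclotomicRealSpace m) (r ⊗ₜ[ℚ] k : ℝ ⊗[ℚ] CyclotomicField m ℚ) =
      r * (Algebra.trace ℚ (CyclotomicField m ℚ) k : ℚ) := by
  have h : Algebra.lmul ℝ (ℝ ⊗[ℚ] CyclotomicField m ℚ) (r ⊗ₜ[ℚ] k) =
      r • (Algebra.lmul ℚ (CyclotomicField m ℚ) k).baseChange ℝ := by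
    ext; simp [TensorProduct.smul_tmul']
  have h' := congrArg (LinearMap.trace ℝ (ℝ ⊗[ℚ] CyclotomicField m ℚ)) h
  rw [map_smul, LinearMap.trace_baseChange] at h'
  exact h'

theorem trace_eq_sum (x : CyclotomicRealSpace m) :
    (Algebra.trace ℝ (CyclotomicRealSpace m) x : ℂ) =
      ∑ φ : CyclotomicField m ℚ →+* ℂ, extendEmbedding m φ x := by
  have key : (Complex.ofRealAm.toLinearMap ∘ₗ Algebra.trace ℝ (CyclotomicRealSpace m) :
      CyclotomicRealSpace m →ₗ[ℝ] ℂ) =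
      ∑ φ : CyclotomicField m ℚ →+* ℂ, (extendEmbedding m φ).toLinearMap := by
    apply LinearMap.ext
    intro x
    refine TensorProduct.induction_on (motive := fun z : ℝ ⊗[ℚ] CyclotomicField m ℚ =>
      (Complex.ofRealAm.toLinearMap ∘ₗ Algebra.trace ℝ (CyclotomicRealSpace m) :
      CyclotomicRealSpace m →ₗ[ℝ] ℂ) z =
      (∑ φ : CyclotomicField m ℚ →+* ℂ, (extendEmbedding m φ).toLinearMap) z) x ?_ ?_ ?_
    · exact (map_zero _).trans (map_zero (∑ φ : CyclotomicField m ℚ →+* ℂ,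
        (extendEmbedding m φ).toLinearMap)).symm
    · intro r k
      have h := trace_eq_sum_embeddings ℂ (K := ℚ) (x := k)
      have h2 : ∑ σ : CyclotomicField m ℚ →ₐ[ℚ] ℂ, σ k =
          ∑ φ : CyclotomicField m ℚ →+* ℂ, φ k :=
        (Fintype.sum_equiv (RingHom.equivRatAlgHom (CyclotomicField m ℚ) ℂ) _ _
          (fun _ => rfl)).symm
      rw [h2] at h
      refine (congrArg Complex.ofReal (trace_tmul m r k)).trans ?_
      refine Eq.trans ?_ (LinearMap.sum_apply Finset.univ
        (fun φ => (extendEmbedding m φ).toLinearMap) _).symm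
      have h3 : ∀ φ : CyclotomicField m ℚ →+* ℂ, (extendEmbedding m φ).toLinearMap
        (r ⊗ₜ[ℚ] k : ℝ ⊗[ℚ] CyclotomicField m ℚ) = r * φ k := fun φ => extendEmbedding_tmul m φ r k
      rw [Finset.sum_congr rfl (fun φ _ => h3 φ), ← Finset.mul_sum, ← h]
      simp
    · intro a b ha hb
      have h1 := map_add (Complex.ofRealAm.toLinearMap ∘ₗ Algebra.trace ℝ (CyclotomicRealSpace m) :
        CyclotomicRealSpace m →ₗ[ℝ] ℂ) a b
      have h2 := map_add (∑ φ : CyclotomicField m ℚ →+* ℂ, (extendEmbedding m φ).toLinearMap) a b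
      exact h1.trans ((congrArg₂ (· + ·) ha hb).trans h2.symm)
  simpa using LinearMap.congr_fun key x

theorem traceForm_eq_sum (x y : CyclotomicRealSpace m) :
    (traceForm m x y : ℂ) =
      ∑ φ : CyclotomicField m ℚ →+* ℂ, extendEmbedding m φ x * conj (extendEmbedding m φ y) := by
  rw [traceForm, trace_eq_sum]
  simp [extendEmbedding_conjugate]

theorem traceForm_self (x : CyclotomicRealSpace m) :
    traceForm m x x = ∑ φ : CyclotomicField m ℚ →+* ℂ, ‖extendEmbedding m φ x‖ ^ 2 := by
  have h := traceForm_eq_sum m x x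
  simp only [Complex.mul_conj'] at h
  exact_mod_cast h

theorem eq_zero_of_extendEmbedding (x : CyclotomicRealSpace m)
    (hx : ∀ φ, extendEmbedding m φ x = 0) : x = 0 := by
  let b : Module.Basis _ ℝ (CyclotomicRealSpace m) :=
    Algebra.TensorProduct.basis ℝ (integralBasis (CyclotomicField m ℚ))
  have hb : ∀ i φ, extendEmbedding m φ (b i) = φ (integralBasis (CyclotomicField m ℚ) i) := by
    intro i φ
    have h1 : b i = (1 ⊗ₜ[ℚ] integralBasis (CyclotomicField m ℚ) i :
      ℝ ⊗[ℚ] CyclotomicField m ℚ) := Algebra.TensorProduct.basis_apply _ _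
    rw [h1, extendEmbedding_tmul]
    simp
  have h0 : ∑ i, (b.repr x i : ℂ) •
      canonicalEmbedding.latticeBasis (CyclotomicField m ℚ) i = 0 := by
    funext φ
    have h := hx φ
    rw [← b.sum_repr x, map_sum] at h
    simpa [hb] using h
  have h1 := Fintype.linearIndependent_iff.1
    (canonicalEmbedding.latticeBasis (CyclotomicField m ℚ)).linearIndependent _ h0
  apply b.ext_elem
  intro i
  simpa using h1 i

/-- The trace form is a scalar product. -/
@[reducible] def innerCore : InnerProductSpace.Core ℝ (CyclotomicRealSpace m) where
  inner x y := traceForm m x y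
  conj_inner_symm x y := by
    have h : ((traceForm m y x : ℝ) : ℂ) = (traceForm m x y : ℝ) := by
      rw [← Complex.conj_ofReal (traceForm m y x), traceForm_eq_sum, traceForm_eq_sum]
      simp [mul_comm]
    simpa using! h
  re_inner_nonneg x := by
    have h := traceForm_self m x
    simp only [RCLike.re_to_real, h]
    positivity
  add_left x y z := by simp [traceForm, add_mul]
  smul_left x y r := by simp [traceForm]
  definite x hx := by
    refine eq_zero_of_extendEmbedding m x fun φ => ?_
    have h := (traceForm_self m x).symm.trans hx
    rw [Finset.sum_eq_zero_iff_of_nonneg (fun _ _ => by positivity)] at h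
    simpa using h φ (Finset.mem_univ φ)

instance : NormedAddCommGroup (CyclotomicRealSpace m) :=
  (innerCore m).toNormedAddCommGroup

instance : InnerProductSpace ℝ (CyclotomicRealSpace m) :=
  InnerProductSpace.ofCore (innerCore m).toCore

theorem inner_eq_traceForm (x y : CyclotomicRealSpace m) :
    inner ℝ x y = Algebra.trace ℝ (CyclotomicRealSpace m) (x * conjugate m y) := rfl

instance : MeasurableSpace (CyclotomicRealSpace m) := borel _

instance : BorelSpace (CyclotomicRealSpace m) := ⟨rfl⟩

end CyclotomicRealSpace

/-! ### Lattices constructed from codes -/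

/-- The Euclidean space `E = (ℚ(ζ_m) ⊗ ℝ)²`, with the scalar product
`⟨x, y⟩ = ⟨x₀, y₀⟩ + ⟨x₁, y₁⟩`. -/
abbrev CyclotomicPlane : Type := PiLp 2 (fun _ : Fin 2 => CyclotomicRealSpace m)

theorem finrank_cyclotomicPlane : Module.finrank ℝ (CyclotomicPlane m) = 2 * m.totient := by
  have h1 : Module.finrank ℝ (CyclotomicRealSpace m) = m.totient :=
    (Module.finrank_baseChange (R := ℝ) (S := ℚ) (M' := CyclotomicField m ℚ)).trans
      (IsCyclotomicExtension.finrank _ (Polynomial.cyclotomic.irreducible_rat (NeZero.pos m)))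
  rw [(WithLp.linearEquiv 2 ℝ (Fin 2 → CyclotomicRealSpace m)).finrank_eq,
    Module.finrank_pi_fintype]
  simp [h1]

variable {m}

/-- The lattice `Λ_C` of the code `C ⊆ F²`, where `F = ℤ[ζ_m] / 𝔓`: the preimage of `C` under the
coordinatewise reduction `Λ₀ = ℤ[ζ_m]² → F² = Λ₀ / 𝔓 Λ₀`, seen in `E`. -/
def codeLattice (P : Ideal (𝓞 (CyclotomicField m ℚ)))
    (C : Submodule (𝓞 (CyclotomicField m ℚ) ⧸ P) (Fin 2 → 𝓞 (CyclotomicField m ℚ) ⧸ P)) :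
    Submodule ℤ (CyclotomicPlane m) where
  carrier := {v | ∃ a : Fin 2 → 𝓞 (CyclotomicField m ℚ),
    (fun i => Ideal.Quotient.mk P (a i)) ∈ C ∧
      ∀ i, v i = CyclotomicRealSpace.of m (a i : CyclotomicField m ℚ)}
  zero_mem' := ⟨0, by simpa only [Pi.zero_apply, map_zero] using! C.zero_mem, by simp⟩
  add_mem' := by
    rintro v w ⟨a, ha, hv⟩ ⟨b, hb, hw⟩
    exact ⟨a + b, by simpa using! C.add_mem ha hb, fun i => by simp [hv, hw]⟩
  smul_mem' := by
    rintro k v ⟨a, ha, hv⟩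
    refine ⟨k • a, ?_, fun i => ?_⟩
    · have := C.toAddSubgroup.zsmul_mem ha k
      simpa using! this
    · simp [hv]

/-- The family `𝓛_𝓒` of the lattices `Λ_C`, where `C` runs through the `F`-lines of `F²`,
`F = ℤ[ζ_m] / 𝔓`. -/
def lineLatticeFamily (P : Ideal (𝓞 (CyclotomicField m ℚ))) :
    Set (Submodule ℤ (CyclotomicPlane m)) :=
  {L | ∃ C : Submodule (𝓞 (CyclotomicField m ℚ) ⧸ P) (Fin 2 → 𝓞 (CyclotomicField m ℚ) ⧸ P),
    Module.finrank (𝓞 (CyclotomicField m ℚ) ⧸ P) C = 1 ∧ L = codeLattice P C}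

/-- `𝔓` is a prime ideal of `ℤ[ζ_m]` lying over a prime number that does not divide `m`. -/
def IsPrimeAwayFromConductor (P : Ideal (𝓞 (CyclotomicField m ℚ))) : Prop :=
  P.IsPrime ∧ ∃ p : ℕ, p.Prime ∧ ¬ p ∣ m ∧ (p : 𝓞 (CyclotomicField m ℚ)) ∈ P

/-- The family `𝓛_𝓒` attached to `𝔓` contains a lattice of density at least
`0.89 * n * log log n / 2 ^ n`, where `n = 2 φ(m)`. -/
def HasDenseLineLattice (P : Ideal (𝓞 (CyclotomicField m ℚ))) : Prop :=
  ∃ L ∈ lineLatticeFamily P, IsEuclideanLattice L ∧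
    0.89 * ((2 * m.totient : ℕ) : ℝ) * Real.log (Real.log ((2 * m.totient : ℕ) : ℝ)) /
      2 ^ (2 * m.totient) ≤ latticeDensity L

end Cyclotomic

/-! ### Choices of prime ideals along the primorials -/

instance primorial_neZero (X : ℕ) : NeZero (primorial X) := ⟨(primorial_pos X).ne'⟩

/-- A choice, for each `X`, of a prime ideal of `ℤ[ζ_m]`, `m` the product of the primes at most
`X`, that lies over a prime number not dividing `m`, where the cardinalities `q` of the residue
fields satisfy `φ(m)² m = o(q ^ (1 / φ(m)))` as `X → ∞`. -/
def IsAdmissibleChoice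
    (P : ∀ X : ℕ, Ideal (𝓞 (CyclotomicField (primorial X) ℚ))) : Prop :=
  (∀ X, IsPrimeAwayFromConductor (P X)) ∧
  (fun X : ℕ => ((primorial X).totient : ℝ) ^ 2 * (primorial X : ℝ)) =o[atTop]
    (fun X : ℕ => (Nat.card (𝓞 (CyclotomicField (primorial X) ℚ) ⧸ P X) : ℝ) ^
      (1 / ((primorial X).totient : ℝ)))

end

/-!
For `c` in `F = ℤ[ζ] / 𝔓`, the line of `F²` through `(1, c)` gives a lattice of index `q = |F|` in
`ℤ[ζ]²`. Two of these `q` lattices meet only in `𝔓²`, whose nonzero vectors are long: their norms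
are multiples of `q`, and by the inequality of the arithmetic and geometric means this bounds
`tr(x x̄)` from below. Multiplication by `ζ` is an isometry, so a nonzero vector that is too short
brings `m` such vectors along. If each of the `q` lattices had one, the ball would contain `m q`
distinct vectors of `ℤ[ζ]²`. For large `q` the number of points of `ℤ[ζ]²` in the ball is about its
volume divided by the covolume, so some lattice of the family has density at least `(1 - ε) m / 2ⁿ`.
By Mertens' third theorem `m / φ(m) ∼ e^γ log X ∼ e^γ log log n`, and with `n = 2 φ(m)` every
constant less than `e^γ / 2 = 0.8905…` is attained.
-/

/-! ### Mertens' third theorem -/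

section Mertens

/-- The logarithm `-log (1 - 1 / p)` of the Euler factor at `1` of a prime `p`. -/
noncomputable def eulerFactorLog (p : ℕ) : ℝ := -Real.log (1 - 1 / (p : ℝ))

/-- The logarithm of the partial Euler product `∏ (1 - 1 / p)⁻¹` over the primes `p ≤ n`. -/
noncomputable def eulerProductLog (n : ℕ) : ℝ := ∑ p ∈ Nat.primesLE n, eulerFactorLog p

/-- The error term of Mertens' first theorem, in the form
`∑ log p * (-log (1 - 1 / p)) = log n + O(1)` that suits the partial Euler products. -/
noncomputable def mertensError (n : ℕ) : ℝ :=
  ∑ p ∈ Nat.primesLE n, Real.log p * eulerFactorLog p - Real.log n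

theorem one_sub_one_div_pos {p : ℕ} (hp : 2 ≤ p) : 0 < 1 - 1 / (p : ℝ) := by
  rw [sub_pos, div_lt_one (by positivity)]
  exact_mod_cast hp

theorem one_div_le_eulerFactorLog {p : ℕ} (hp : 2 ≤ p) : 1 / (p : ℝ) ≤ eulerFactorLog p := by
  have := Real.log_le_sub_one_of_pos (one_sub_one_div_pos hp)
  unfold eulerFactorLog
  linarith

theorem eulerFactorLog_le_one_div_sub_one {p : ℕ} (hp : 2 ≤ p) :
    eulerFactorLog p ≤ 1 / ((p : ℝ) - 1) := by
  have hp' : (2 : ℝ) ≤ p := by exact_mod_cast hp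
  calc eulerFactorLog p = Real.log (1 - 1 / (p : ℝ))⁻¹ := (Real.log_inv _).symm
    _ ≤ (1 - 1 / (p : ℝ))⁻¹ - 1 :=
      Real.log_le_sub_one_of_pos (inv_pos.2 (one_sub_one_div_pos hp))
    _ = 1 / ((p : ℝ) - 1) := by
      have : (p : ℝ) - 1 ≠ 0 := by linarith
      field_simp
      ring

theorem eulerFactorLog_nonneg {p : ℕ} (hp : 2 ≤ p) : 0 ≤ eulerFactorLog p :=
  le_trans (by positivity) (one_div_le_eulerFactorLog hp)

theorem factorization_factorial_le_div_sub_one {p : ℕ} (n : ℕ) (hp : p.Prime) :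
    (n.factorial.factorization p : ℝ) ≤ n / ((p : ℝ) - 1) :=
  calc (n.factorial.factorization p : ℝ) ≤ ((n / (p - 1) : ℕ) : ℝ) := by
        exact_mod_cast Nat.factorization_factorial_le_div_pred hp n
    _ ≤ n / ((p - 1 : ℕ) : ℝ) := Nat.cast_div_le
    _ = n / ((p : ℝ) - 1) := by rw [Nat.cast_sub hp.one_le, Nat.cast_one]

theorem div_sub_one_le_factorization_factorial {p : ℕ} (n : ℕ) (hp : p.Prime) :
    (n : ℝ) / p - 1 ≤ n.factorial.factorization p := by
  have hdiv : n / p ≤ n.factorial.factorization p :=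
    calc n / p ≤ (p * (n / p)).factorial.factorization p := by
          rw [Nat.factorization_factorial_mul hp]
          exact Nat.le_add_left _ _
      _ ≤ n.factorial.factorization p :=
        (Nat.factorization_le_iff_dvd (Nat.factorial_ne_zero _) (Nat.factorial_ne_zero _)).2
          (Nat.factorial_dvd_factorial (Nat.mul_div_le n p)) p
  have hfloor := Nat.lt_floor_add_one ((n : ℝ) / p)
  rw [Nat.floor_div_eq_div] at hfloor
  have : ((n / p : ℕ) : ℝ) ≤ n.factorial.factorization p := by exact_mod_cast hdiv
  linarith

theorem log_factorial_eq_sum_primesLE (n : ℕ) : Real.log n.factorial =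
    ∑ p ∈ Nat.primesLE n, (n.factorial.factorization p : ℝ) * Real.log p := by
  rw [Real.log_nat_eq_sum_factorization]
  refine Finsupp.sum_of_support_subset _ (fun p hp => ?_) _ (by simp)
  rw [Nat.support_factorization, Nat.mem_primeFactors] at hp
  exact Nat.mem_primesLE.2 ⟨hp.1.dvd_factorial.1 hp.2.1, hp.1⟩

theorem log_factorial_le (n : ℕ) : Real.log n.factorial ≤ n * Real.log n := by
  rw [← Real.log_pow]
  exact Real.log_le_log (by exact_mod_cast n.factorial_pos) (by exact_mod_cast n.factorial_le_pow)

theorem mul_log_sub_le_log_factorial (n : ℕ) :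
    n * Real.log n - n ≤ Real.log n.factorial := by
  rcases eq_or_ne n 0 with rfl | hn
  · simp
  · have hstirling := Stirling.le_log_factorial_stirling hn
    have hlog := Real.log_natCast_nonneg n
    have hpi : 0 ≤ Real.log (2 * Real.pi) := Real.log_nonneg (by linarith [Real.pi_gt_three])
    linarith

theorem log_four_le_two : Real.log 4 ≤ 2 := by
  have h4 : Real.log 4 = 2 * Real.log 2 := by
    rw [show (4 : ℝ) = 2 ^ 2 by norm_num, Real.log_pow, Nat.cast_ofNat]
  linarith [Real.log_two_lt_d9]

theorem sum_log_div_primesLE_le (n : ℕ) :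
    ∑ p ∈ Nat.primesLE n, Real.log p / p ≤ Real.log n + 2 := by
  rcases Nat.eq_zero_or_pos n with rfl | hn
  · simp
  have hn0 : (0 : ℝ) < n := by exact_mod_cast hn
  have hfactorial : n * ∑ p ∈ Nat.primesLE n, Real.log p / p - Chebyshev.theta n ≤
      Real.log n.factorial := by
    rw [log_factorial_eq_sum_primesLE, Finset.mul_sum, Chebyshev.theta_eq_sum_primesLE_log,
      ← Finset.sum_sub_distrib]
    refine Finset.sum_le_sum fun p hp => ?_
    calc n * (Real.log p / p) - Real.log p = (n / p - 1) * Real.log p := by ring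
      _ ≤ _ := mul_le_mul_of_nonneg_right
        (div_sub_one_le_factorization_factorial n (Nat.prime_of_mem_primesLE hp))
        (Real.log_natCast_nonneg p)
  have htheta : Chebyshev.theta n ≤ 2 * n := (Chebyshev.theta_le_log4_mul_x hn0.le).trans
    (mul_le_mul_of_nonneg_right log_four_le_two hn0.le)
  refine le_of_mul_le_mul_left ?_ hn0
  linarith [log_factorial_le n]

theorem log_sub_one_le_sum_log_div_sub_one (n : ℕ) :
    Real.log n - 1 ≤ ∑ p ∈ Nat.primesLE n, Real.log p / ((p : ℝ) - 1) := by
  rcases Nat.eq_zero_or_pos n with rfl | hn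
  · simp
  have hfactorial : Real.log n.factorial ≤
      n * ∑ p ∈ Nat.primesLE n, Real.log p / ((p : ℝ) - 1) := by
    rw [log_factorial_eq_sum_primesLE, Finset.mul_sum]
    refine Finset.sum_le_sum fun p hp => ?_
    rw [← mul_comm_div]
    exact mul_le_mul_of_nonneg_right
      (factorization_factorial_le_div_sub_one n (Nat.prime_of_mem_primesLE hp))
      (Real.log_natCast_nonneg p)
  refine le_of_mul_le_mul_left ?_ (by exact_mod_cast hn : (0 : ℝ) < n)
  linarith [mul_log_sub_le_log_factorial n]

theorem log_div_sub_one_sub_log_div_le {p : ℕ} (hp : 2 ≤ p) :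
    Real.log p / ((p : ℝ) - 1) - Real.log p / p ≤ 4 * (p : ℝ) ^ (-(3 / 2) : ℝ) := by
  have hp' : (2 : ℝ) ≤ p := by exact_mod_cast hp
  have hlog : Real.log p ≤ 2 * (p : ℝ) ^ (1 / 2 : ℝ) := by
    have := Real.log_le_rpow_div (x := (p : ℝ)) (by linarith) (ε := 1 / 2) (by norm_num)
    linarith
  have hpow : (p : ℝ) ^ (1 / 2 : ℝ) = (p : ℝ) ^ (-(3 / 2) : ℝ) * (p : ℝ) ^ 2 := by
    rw [← Real.rpow_natCast, ← Real.rpow_add (by linarith)]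
    norm_num
  calc Real.log p / ((p : ℝ) - 1) - Real.log p / p = Real.log p / (p * (p - 1)) := by
        have : (p : ℝ) - 1 ≠ 0 := by linarith
        field_simp
        ring
    _ ≤ 2 * ((p : ℝ) ^ (-(3 / 2) : ℝ) * (p : ℝ) ^ 2) / (p * (p - 1)) :=
      div_le_div_of_nonneg_right (hlog.trans_eq (by rw [hpow])) (by nlinarith)
    _ = (p : ℝ) ^ (-(3 / 2) : ℝ) * (2 * p / (p - 1)) := by
      have : (p : ℝ) - 1 ≠ 0 := by linarith
      field_simp
    _ ≤ (p : ℝ) ^ (-(3 / 2) : ℝ) * 4 :=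
      mul_le_mul_of_nonneg_left ((div_le_iff₀ (by linarith)).2 (by linarith)) (by positivity)
    _ = 4 * (p : ℝ) ^ (-(3 / 2) : ℝ) := mul_comm _ _

theorem exists_sum_log_div_sub_one_sub_log_div_le : ∃ C : ℝ, ∀ n : ℕ,
    ∑ p ∈ Nat.primesLE n, (Real.log p / ((p : ℝ) - 1) - Real.log p / p) ≤ C := by
  have hs : Summable fun n : ℕ => 4 * (n : ℝ) ^ (-(3 / 2) : ℝ) :=
    (Real.summable_nat_rpow.2 (by norm_num)).mul_left _
  exact ⟨_, fun n => (Finset.sum_le_sum fun p hp =>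
    log_div_sub_one_sub_log_div_le (Nat.two_le_of_mem_primesLE hp)).trans
      (hs.sum_le_tsum (Nat.primesLE n) fun _ _ => by positivity)⟩

theorem exists_abs_mertensError_le : ∃ C : ℝ, ∀ n : ℕ, |mertensError n| ≤ C := by
  obtain ⟨C, hC⟩ := exists_sum_log_div_sub_one_sub_log_div_le
  refine ⟨|C| + 2, fun n => ?_⟩
  have hupper : ∑ p ∈ Nat.primesLE n, Real.log p * eulerFactorLog p ≤
      ∑ p ∈ Nat.primesLE n, Real.log p / ((p : ℝ) - 1) := Finset.sum_le_sum fun p hp => by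
    rw [div_eq_mul_one_div]
    exact mul_le_mul_of_nonneg_left
      (eulerFactorLog_le_one_div_sub_one (Nat.two_le_of_mem_primesLE hp))
      (Real.log_natCast_nonneg p)
  have hlower : ∑ p ∈ Nat.primesLE n, Real.log p / p ≤
      ∑ p ∈ Nat.primesLE n, Real.log p * eulerFactorLog p := Finset.sum_le_sum fun p hp => by
    rw [div_eq_mul_one_div]
    exact mul_le_mul_of_nonneg_left
      (one_div_le_eulerFactorLog (Nat.two_le_of_mem_primesLE hp)) (Real.log_natCast_nonneg p)
  have hgap := hC n
  rw [Finset.sum_sub_distrib] at hgap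
  have hsum := sum_log_div_primesLE_le n
  have hsum' := log_sub_one_le_sum_log_div_sub_one n
  rw [mertensError, abs_le]
  constructor <;> linarith [le_abs_self C]

theorem log_mul_eulerProductLog_succ_sub (n : ℕ) :
    Real.log (n + 1 : ℕ) * (eulerProductLog (n + 1) - eulerProductLog n) =
      Real.log (n + 1 : ℕ) - Real.log n + mertensError (n + 1) - mertensError n := by
  simp only [eulerProductLog, mertensError, Nat.primesLE_succ]
  split_ifs
  · rw [Finset.sum_insert (Nat.notMem_primesLE n), Finset.sum_insert (Nat.notMem_primesLE n)]
    ring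
  · ring

theorem eulerProductLog_succ_sub_le {C : ℝ} {n : ℕ} (hn : 2 ≤ n) (hC : mertensError n ≤ C) :
    eulerProductLog (n + 1) - Real.log (Real.log (n + 1 : ℕ)) -
        (mertensError (n + 1) - C) / Real.log (n + 1 : ℕ) ≤
      eulerProductLog n - Real.log (Real.log n) - (mertensError n - C) / Real.log n := by
  have hL : 0 < Real.log n := Real.log_pos (by exact_mod_cast hn)
  have hLL' : Real.log n ≤ Real.log (n + 1 : ℕ) :=
    Real.log_le_log (by positivity) (by exact_mod_cast n.le_succ)
  have hsucc := log_mul_eulerProductLog_succ_sub n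
  generalize Real.log (n + 1 : ℕ) = L' at hsucc hLL' ⊢
  have hL' : 0 < L' := hL.trans_le hLL'
  have hloglog : 1 - Real.log n / L' ≤ Real.log L' - Real.log (Real.log n) := by
    have := Real.log_le_sub_one_of_pos (div_pos hL hL')
    rw [Real.log_div hL.ne' hL'.ne'] at this
    linarith
  have hmul : (C - mertensError n) / L' ≤ (C - mertensError n) / Real.log n :=
    div_le_div_of_nonneg_left (sub_nonneg.2 hC) hL hLL'
  have hstep : eulerProductLog (n + 1) - eulerProductLog n = 1 - Real.log n / L' +
      (mertensError (n + 1) - C) / L' + (C - mertensError n) / L' := by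
    field_simp
    linarith
  have hneg : (mertensError n - C) / Real.log n = -((C - mertensError n) / Real.log n) := by ring
  linarith

theorem exists_eulerProductLog_sub_log_log_le : ∃ C : ℝ, ∀ x y : ℕ, 2 ≤ x → x ≤ y →
    eulerProductLog y - Real.log (Real.log y) ≤
      eulerProductLog x - Real.log (Real.log x) + C / Real.log x := by
  obtain ⟨C, hC⟩ := exists_abs_mertensError_le
  refine ⟨2 * C, fun x y hx hxy => ?_⟩
  have hlog {n : ℕ} (hn : 2 ≤ n) : 0 < Real.log n := Real.log_pos (by exact_mod_cast hn)
  have hanti := antitoneOn_nat_Ici_of_succ_le (k := 2) (f := fun n : ℕ =>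
      eulerProductLog n - Real.log (Real.log n) - (mertensError n - C) / Real.log n)
    (fun n hn => eulerProductLog_succ_sub_le hn (le_of_abs_le (hC n))) hx (hx.trans hxy) hxy
  have hy : (mertensError y - C) / Real.log y ≤ 0 :=
    div_nonpos_of_nonpos_of_nonneg (sub_nonpos.2 (le_of_abs_le (hC y))) (hlog (hx.trans hxy)).le
  have hx' : (C - mertensError x) / Real.log x ≤ 2 * C / Real.log x :=
    div_le_div_of_nonneg_right (by linarith [neg_le_of_abs_le (hC x)]) (hlog hx).le
  have hneg : (mertensError x - C) / Real.log x = -((C - mertensError x) / Real.log x) := by ring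
  simp only at hanti
  linarith

theorem one_div_le_tsum_rpow_neg {s : ℝ} (hs : 0 < s) :
    1 / s ≤ ∑' n : ℕ, (n : ℝ) ^ (-(1 + s)) := by
  have hsum : Summable fun n : ℕ => (n : ℝ) ^ (-(1 + s)) :=
    Real.summable_nat_rpow.2 (by linarith)
  have hanti : AntitoneOn (fun t : ℝ => t ^ (-(1 + s))) (Set.Ici ((1 : ℕ) : ℝ)) := by
    intro a ha b _ hab
    have ha1 : (1 : ℝ) ≤ a := by simpa using ha
    exact Real.rpow_le_rpow_of_nonpos (by linarith) hab (by linarith)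
  have hpos : ∀ t ∈ Set.Ioi ((1 : ℕ) : ℝ), 0 ≤ t ^ (-(1 + s)) := by
    intro t ht
    have ht1 : (1 : ℝ) < t := by simpa using ht
    positivity
  calc 1 / s = ∫ t in Set.Ioi ((1 : ℕ) : ℝ), t ^ (-(1 + s)) := by
        rw [Nat.cast_one, integral_Ioi_rpow_of_lt (by linarith) one_pos, Real.one_rpow,
          show -(1 + s) + 1 = -s by ring, neg_div_neg_eq]
    _ ≤ ∑' n : ℕ, ((n + 1 : ℕ) : ℝ) ^ (-(1 + s)) :=
      hanti.integral_le_tsum_comp_add 1 hsum hpos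
    _ ≤ ∑' n : ℕ, (n : ℝ) ^ (-(1 + s)) := by
      rw [← hsum.sum_add_tsum_nat_add 1]
      exact le_add_of_nonneg_left (Finset.sum_nonneg fun i _ => by positivity)

theorem inv_one_sub_rpow_le_exp {p : ℕ} (hp : 2 ≤ p) {s : ℝ} (hs : 0 ≤ s) :
    (1 - (p : ℝ) ^ (-(1 + s)))⁻¹ ≤ Real.exp (eulerFactorLog p * (p : ℝ) ^ (-s)) := by
  have hp' : (2 : ℝ) ≤ p := by exact_mod_cast hp
  have hfactor := one_sub_one_div_pos hp
  have hpow : (p : ℝ) ^ (-s) ≤ 1 :=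
    Real.rpow_le_one_of_one_le_of_nonpos (by linarith) (by linarith)
  have hbernoulli := rpow_one_add_le_one_add_mul_self (s := -(1 / (p : ℝ))) (by linarith)
    (by positivity) hpow
  have hexp : (1 + -(1 / (p : ℝ))) ^ ((p : ℝ) ^ (-s)) =
      (Real.exp (eulerFactorLog p * (p : ℝ) ^ (-s)))⁻¹ := by
    rw [← sub_eq_add_neg, Real.rpow_def_of_pos hfactor, ← Real.exp_neg, eulerFactorLog, neg_mul,
      neg_neg]
  have hsplit : (p : ℝ) ^ (-(1 + s)) = (p : ℝ) ^ (-s) * (1 / p) := by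
    rw [show -(1 + s) = -s + -1 by ring, Real.rpow_add (by linarith), Real.rpow_neg_one, one_div]
  refine inv_le_of_inv_le₀ (Real.exp_pos _) ?_
  rw [hsplit, ← hexp]
  linarith

theorem log_one_div_le_of_forall_sum_le {s b : ℝ} (hs : 0 < s)
    (h : ∀ S : Finset Nat.Primes, ∑ p ∈ S, eulerFactorLog p * ((p : ℕ) : ℝ) ^ (-s) ≤ b) :
    Real.log (1 / s) ≤ b := by
  let f : ℕ →*₀ ℝ :=
    { toFun n := (n : ℝ) ^ (-(1 + s))
      map_zero' := by rw [Nat.cast_zero, Real.zero_rpow (by linarith)]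
      map_one' := by simp
      map_mul' m n := by
        rw [Nat.cast_mul, Real.mul_rpow (Nat.cast_nonneg _) (Nat.cast_nonneg _)] }
  have hsum : Summable fun n : ℕ => (n : ℝ) ^ (-(1 + s)) :=
    Real.summable_nat_rpow.2 (by linarith)
  have hprod := EulerProduct.eulerProduct_completely_multiplicative_hasProd (f := f) hsum.norm
  have hle : ∑' n, f n ≤ Real.exp b := by
    refine le_of_tendsto' hprod fun S => ?_
    calc ∏ p ∈ S, (1 - f p)⁻¹
        ≤ ∏ p ∈ S, Real.exp (eulerFactorLog p * ((p : ℕ) : ℝ) ^ (-s)) := by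
          refine Finset.prod_le_prod (fun p _ => ?_) fun p _ =>
            inv_one_sub_rpow_le_exp p.2.two_le hs.le
          rw [inv_nonneg, sub_nonneg]
          exact Real.rpow_le_one_of_one_le_of_nonpos (by exact_mod_cast p.2.one_le) (by linarith)
      _ ≤ Real.exp b := by
          rw [← Real.exp_sum]
          exact Real.exp_le_exp.2 (h S)
  rw [Real.log_le_iff_le_exp (by positivity)]
  exact (one_div_le_tsum_rpow_neg hs).trans hle

theorem hasSum_ite_le_pow {z : ℝ} (h0 : 0 ≤ z) (h1 : z < 1) (k : ℕ) :
    HasSum (fun j => if k ≤ j then z ^ j else 0) (z ^ k * (1 - z)⁻¹) := by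
  have hinj : Function.Injective (fun j : ℕ => j + k) := add_left_injective k
  rw [← hinj.hasSum_iff fun j hj => if_neg fun hkj => hj ⟨j - k, by simp [hkj]⟩]
  refine ((hasSum_geometric_of_lt_one h0 h1).mul_left (z ^ k)).congr_fun fun j => ?_
  simp [pow_add, mul_comm]

theorem hasSum_pow_mul_sum_filter_le {ι : Type*} (S : Finset ι) (a : ι → ℝ) (k : ι → ℕ) {z : ℝ}
    (h0 : 0 ≤ z) (h1 : z < 1) :
    HasSum (fun j => z ^ j * ∑ i ∈ S with k i ≤ j, a i)
      ((∑ i ∈ S, a i * z ^ k i) * (1 - z)⁻¹) := by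
  rw [Finset.sum_mul]
  simp only [mul_assoc]
  refine (hasSum_sum fun i _ => (hasSum_ite_le_pow h0 h1 (k i)).mul_left (a i)).congr_fun
    fun j => ?_
  rw [Finset.sum_filter, Finset.mul_sum]
  exact Finset.sum_congr rfl fun i _ => by split_ifs <;> ring

theorem sum_eulerFactorLog_floor_log_le (S : Finset Nat.Primes) (j : ℕ) :
    ∑ p ∈ S with ⌊Real.log (p : Nat.Primes)⌋₊ ≤ j, eulerFactorLog p ≤
      eulerProductLog ⌊Real.exp (j + 1)⌋₊ := by
  refine (Finset.sum_map (S.filter _) ⟨_, Nat.Primes.coe_nat_injective⟩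
    eulerFactorLog).symm.trans_le (Finset.sum_le_sum_of_subset_of_nonneg ?_ fun p hp _ =>
      eulerFactorLog_nonneg (Nat.two_le_of_mem_primesLE hp))
  intro p hp
  simp only [Finset.mem_map, Finset.mem_filter] at hp
  obtain ⟨p, ⟨_, hpj⟩, rfl⟩ := hp
  refine Nat.mem_primesLE.2 ⟨Nat.le_floor ?_, p.2⟩
  rw [← Real.log_le_iff_le_exp (by exact_mod_cast p.2.pos)]
  refine (Nat.lt_floor_add_one _).le.trans ?_
  gcongr
  exact hpj

theorem log_one_div_le_of_eulerProductLog_le {s : ℝ} (hs : 0 < s) {B : ℕ → ℝ} {V : ℝ}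
    (hB : ∀ j : ℕ, eulerProductLog ⌊Real.exp (j + 1)⌋₊ ≤ B j)
    (hV : HasSum (fun j => Real.exp (-s) ^ j * B j) V) :
    Real.log (1 / s) ≤ (1 - Real.exp (-s)) * V := by
  set z := Real.exp (-s) with hz
  have hz0 : 0 < z := Real.exp_pos _
  have hz1 : z < 1 := Real.exp_lt_one_iff.2 (by linarith)
  refine log_one_div_le_of_forall_sum_le hs fun S => ?_
  have hrpow (p : Nat.Primes) : ((p : ℕ) : ℝ) ^ (-s) ≤ z ^ ⌊Real.log (p : ℕ)⌋₊ := by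
    rw [Real.rpow_def_of_pos (by exact_mod_cast p.2.pos), hz, ← Real.exp_nat_mul]
    refine Real.exp_le_exp.2 ?_
    have := Nat.floor_le (Real.log_natCast_nonneg (p : ℕ))
    nlinarith
  have hle : (∑ p ∈ S, eulerFactorLog p * z ^ ⌊Real.log (p : ℕ)⌋₊) * (1 - z)⁻¹ ≤ V :=
    hasSum_le (fun j => mul_le_mul_of_nonneg_left
      ((sum_eulerFactorLog_floor_log_le S j).trans (hB j)) (by positivity))
      (hasSum_pow_mul_sum_filter_le S _ _ hz0.le hz1) hV
  calc ∑ p ∈ S, eulerFactorLog p * ((p : ℕ) : ℝ) ^ (-s)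
      ≤ ∑ p ∈ S, eulerFactorLog p * z ^ ⌊Real.log (p : ℕ)⌋₊ := Finset.sum_le_sum fun p _ =>
        mul_le_mul_of_nonneg_left (hrpow p) (eulerFactorLog_nonneg p.2.two_le)
    _ ≤ (1 - z) * V := by
      rwa [← div_eq_mul_inv, div_le_iff₀' (by linarith)] at hle

theorem hasSum_pow_mul_harmonic {z : ℝ} (h0 : 0 < z) (h1 : z < 1) :
    HasSum (fun j : ℕ => z ^ j * (harmonic (j + 1) : ℝ))
      (-Real.log (1 - z) / z * (1 - z)⁻¹) := by
  have hlog : HasSum (fun n : ℕ => z ^ n / (n + 1)) (-Real.log (1 - z) / z) := by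
    have h := (Real.hasSum_pow_div_log_of_abs_lt_one (x := z) (by rwa [abs_of_pos h0])).div_const z
    refine h.congr_fun fun n => ?_
    rw [pow_succ]
    field_simp
  have hgeom := hasSum_geometric_of_lt_one h0.le h1
  have h := hasSum_sum_range_mul_of_summable_norm hlog.summable.norm hgeom.summable.norm
  rw [hlog.tsum_eq, hgeom.tsum_eq] at h
  refine h.congr_fun fun j => ?_
  rw [harmonic]
  push_cast
  rw [Finset.mul_sum]
  refine Finset.sum_congr rfl fun k hk => ?_
  have hkj : k ≤ j := by simpa [Nat.lt_succ_iff] using hk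
  rw [div_mul_eq_mul_div, ← pow_add, Nat.add_sub_cancel' hkj, div_eq_mul_inv]

theorem tendsto_log_one_sub_exp_neg_sub_log :
    Tendsto (fun s : ℝ => Real.log (1 - Real.exp (-s)) - Real.log s) (𝓝[>] 0) (𝓝 0) := by
  have hderiv : HasDerivAt (fun s : ℝ => 1 - Real.exp (-s)) 1 0 := by
    simpa using! ((hasDerivAt_id (0 : ℝ)).neg.exp).const_sub 1
  have hslope : Tendsto (fun s : ℝ => (1 - Real.exp (-s)) / s) (𝓝[>] 0) (𝓝 1) := by
    simpa [div_eq_inv_mul] using hderiv.tendsto_slope_zero_right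
  have hlog := (Real.continuousAt_log one_ne_zero).tendsto.comp hslope
  rw [Real.log_one] at hlog
  refine hlog.congr' ?_
  filter_upwards [self_mem_nhdsWithin] with s (hs : 0 < s)
  have hpos : 0 < 1 - Real.exp (-s) := sub_pos.2 (Real.exp_lt_one_iff.2 (by linarith))
  exact Real.log_div hpos.ne' hs.ne'

theorem tendsto_log_sub_log_one_sub_exp_neg_div_exp_neg :
    Tendsto (fun s : ℝ => Real.log s - Real.log (1 - Real.exp (-s)) / Real.exp (-s))
      (𝓝[>] 0) (𝓝 0) := by
  have hone_sub : Tendsto (fun s : ℝ => 1 - Real.exp (-s)) (𝓝[>] 0) (𝓝 0) := by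
    have : Continuous fun s : ℝ => 1 - Real.exp (-s) := by fun_prop
    simpa using (this.tendsto 0).mono_left nhdsWithin_le_nhds
  have hmul_log : Tendsto (fun s : ℝ => (1 - Real.exp (-s)) * Real.log (1 - Real.exp (-s)))
      (𝓝[>] 0) (𝓝 0) := by
    simpa [Function.comp_def] using (Real.continuous_mul_log.tendsto 0).comp hone_sub
  have hexp : Tendsto (fun s : ℝ => Real.exp s) (𝓝[>] 0) (𝓝 1) := by
    simpa using (Real.continuous_exp.tendsto 0).mono_left nhdsWithin_le_nhds
  have h := (tendsto_log_one_sub_exp_neg_sub_log.add (hexp.mul hmul_log)).neg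
  simp only [mul_zero, add_zero, neg_zero] at h
  refine h.congr fun s => ?_
  rw [← mul_assoc, mul_sub, ← Real.exp_add, add_neg_cancel, Real.exp_zero, div_eq_mul_inv,
    ← Real.exp_neg, neg_neg]
  ring

theorem log_one_div_le_of_forall_eulerProductLog_le_harmonic_add {s b : ℝ} (hs : 0 < s) {N : ℕ}
    (h : ∀ j ≥ N, eulerProductLog ⌊Real.exp (j + 1)⌋₊ ≤ harmonic (j + 1) + b) :
    Real.log (1 / s) ≤ -Real.log (1 - Real.exp (-s)) / Real.exp (-s) + b +
      (1 - Real.exp (-s)) * ∑ j ∈ Finset.range N, Real.exp (-s) ^ j *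
        (eulerProductLog ⌊Real.exp (j + 1)⌋₊ - (harmonic (j + 1) + b)) := by
  set z := Real.exp (-s)
  have hz0 : 0 < z := Real.exp_pos _
  have hz1 : z < 1 := Real.exp_lt_one_iff.2 (by linarith)
  set D : ℕ → ℝ := fun j => eulerProductLog ⌊Real.exp (j + 1)⌋₊ - (harmonic (j + 1) + b) with hD
  have hB (j : ℕ) : eulerProductLog ⌊Real.exp (j + 1)⌋₊ ≤
      harmonic (j + 1) + b + if j < N then D j else 0 := by
    split_ifs with hj
    · simp [hD]
    · simpa using h j (not_lt.1 hj)
  have hfinite : HasSum (fun j => z ^ j * if j < N then D j else 0)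
      (∑ j ∈ Finset.range N, z ^ j * D j) := by
    rw [show ∑ j ∈ Finset.range N, z ^ j * D j =
        ∑ j ∈ Finset.range N, z ^ j * (if j < N then D j else 0) from
      Finset.sum_congr rfl fun j hj => by rw [if_pos (Finset.mem_range.1 hj)]]
    exact hasSum_sum_of_ne_finset_zero fun j hj => by
      rw [if_neg (by simpa using hj), mul_zero]
  have hle : _ ≤ (1 - z) * _ := log_one_div_le_of_eulerProductLog_le hs hB
    ((((hasSum_pow_mul_harmonic hz0 hz1).add
      ((hasSum_geometric_of_lt_one hz0.le hz1).mul_right b)).add hfinite).congr_fun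
        fun j => by ring)
  refine hle.trans_eq ?_
  have : 1 - z ≠ 0 := by linarith
  generalize ∑ j ∈ Finset.range N, z ^ j * D j = W
  field_simp

theorem nonneg_of_eventually_eulerProductLog_le_harmonic_add {b : ℝ}
    (h : ∀ᶠ j : ℕ in atTop, eulerProductLog ⌊Real.exp (j + 1)⌋₊ ≤ harmonic (j + 1) + b) :
    0 ≤ b := by
  obtain ⟨N, hN⟩ := eventually_atTop.1 h
  have hsum : Tendsto (fun s : ℝ => (1 - Real.exp (-s)) *
      ∑ j ∈ Finset.range N, Real.exp (-s) ^ j *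
        (eulerProductLog ⌊Real.exp (j + 1)⌋₊ - (harmonic (j + 1) + b))) (𝓝[>] 0) (𝓝 0) := by
    have : Continuous fun s : ℝ => (1 - Real.exp (-s)) *
        ∑ j ∈ Finset.range N, Real.exp (-s) ^ j *
          (eulerProductLog ⌊Real.exp (j + 1)⌋₊ - (harmonic (j + 1) + b)) := by fun_prop
    simpa using (this.tendsto 0).mono_left nhdsWithin_le_nhds
  have hlim := (tendsto_log_sub_log_one_sub_exp_neg_div_exp_neg.add_const b).add hsum
  rw [zero_add, add_zero] at hlim
  refine ge_of_tendsto hlim ?_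
  filter_upwards [self_mem_nhdsWithin] with s (hs : 0 < s)
  have hle := log_one_div_le_of_forall_eulerProductLog_le_harmonic_add hs hN
  rw [one_div, Real.log_inv, neg_div] at hle
  linarith

theorem log_log_floor_exp_le {j : ℕ} (hj : 1 ≤ j) :
    Real.log (Real.log ⌊Real.exp (j + 1)⌋₊) ≤
      harmonic (j + 1) - Real.eulerMascheroniConstant := by
  have hfloor : 2 ≤ ⌊Real.exp ((j : ℝ) + 1)⌋₊ := Nat.le_floor (by
    have hj' : (1 : ℝ) ≤ j := by exact_mod_cast hj
    push_cast
    linarith [Real.add_one_le_exp ((j : ℝ) + 1)])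
  have hfloor' : (2 : ℝ) ≤ ⌊Real.exp ((j : ℝ) + 1)⌋₊ := by exact_mod_cast hfloor
  have hlog : Real.log ⌊Real.exp ((j : ℝ) + 1)⌋₊ ≤ j + 1 := by
    rw [Real.log_le_iff_le_exp (by linarith)]
    exact Nat.floor_le (Real.exp_pos _).le
  have hharmonic := Real.eulerMascheroniConstant_lt_eulerMascheroniSeq' (j + 1)
  simp only [Real.eulerMascheroniSeq', Nat.succ_ne_zero, if_false] at hharmonic
  push_cast at hharmonic
  linarith [Real.log_le_log (Real.log_pos (by linarith)) hlog]

theorem eulerMascheroniConstant_le_of_eventually_eulerProductLog_le {b : ℝ}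
    (h : ∀ᶠ n : ℕ in atTop, eulerProductLog n ≤ Real.log (Real.log n) + b) :
    Real.eulerMascheroniConstant ≤ b := by
  have htendsto : Tendsto (fun j : ℕ => ⌊Real.exp (j + 1)⌋₊) atTop atTop :=
    tendsto_nat_floor_atTop.comp (Real.tendsto_exp_atTop.comp
      (tendsto_atTop_add_const_right _ _ tendsto_natCast_atTop_atTop))
  rw [← sub_nonneg]
  refine nonneg_of_eventually_eulerProductLog_le_harmonic_add ?_
  filter_upwards [htendsto.eventually h, eventually_ge_atTop 1] with j hj hj1
  linarith [log_log_floor_exp_le hj1]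

theorem eventually_log_log_add_le_eulerProductLog {b : ℝ} (hb : b < Real.eulerMascheroniConstant) :
    ∀ᶠ X : ℕ in atTop, Real.log (Real.log X) + b ≤ eulerProductLog X := by
  obtain ⟨b', hbb', hb'⟩ := exists_between hb
  obtain ⟨C, hC⟩ := exists_eulerProductLog_sub_log_log_le
  have hlim : Tendsto (fun X : ℕ => C / Real.log X) atTop (𝓝 0) :=
    (Real.tendsto_log_atTop.comp tendsto_natCast_atTop_atTop).const_div_atTop C
  filter_upwards [eventually_ge_atTop 2, hlim.eventually_lt_const (sub_pos.2 hbb')] with X hX hCX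
  by_contra! hlt
  refine hb'.not_ge (eulerMascheroniConstant_le_of_eventually_eulerProductLog_le ?_)
  filter_upwards [eventually_ge_atTop X] with y hy
  linarith [hC X y hX hy]

theorem eventually_mul_log_le_exp_eulerProductLog {c : ℝ}
    (hc : c < Real.exp Real.eulerMascheroniConstant) :
    ∀ᶠ X : ℕ in atTop, c * Real.log X ≤ Real.exp (eulerProductLog X) := by
  obtain ⟨b, hb, hcb⟩ := ((Real.continuous_exp.tendsto _).eventually_const_lt hc).exists_lt
  filter_upwards [eventually_log_log_add_le_eulerProductLog hb, eventually_ge_atTop 2] with X hX hX2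
  have hlog : 0 < Real.log X := Real.log_pos (by exact_mod_cast hX2)
  calc c * Real.log X ≤ Real.exp b * Real.log X := mul_le_mul_of_nonneg_right hcb.le hlog.le
    _ = Real.exp (Real.log (Real.log X) + b) := by
      rw [Real.exp_add, Real.exp_log hlog, mul_comm]
    _ ≤ Real.exp (eulerProductLog X) := Real.exp_le_exp.2 hX

theorem log_le_sub_inv_div_two {w : ℝ} (hw : 1 ≤ w) : Real.log w ≤ (w - w⁻¹) / 2 := by
  rw [← Real.sinh_log (by linarith)]
  exact Real.self_le_sinh_iff.2 (Real.log_nonneg hw)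

theorem log_succ_sub_log_le {k : ℕ} (hk : 1 ≤ k) :
    Real.log (k + 1 : ℕ) - Real.log k ≤ 1 / (2 * k) + 1 / (2 * (k + 1 : ℕ)) := by
  have hk0 : (0 : ℝ) < k := by exact_mod_cast hk
  have hw : 1 ≤ ((k : ℝ) + 1) / k := by
    rw [le_div_iff₀ hk0]
    linarith
  rw [Nat.cast_add_one, ← Real.log_div (by positivity) hk0.ne']
  refine (log_le_sub_inv_div_two hw).trans_eq ?_
  field_simp
  ring

theorem harmonic_sub_log_sub_le_eulerMascheroniConstant {n : ℕ} (hn : 1 ≤ n) :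
    (harmonic n : ℝ) - Real.log n - 1 / (2 * n) ≤ Real.eulerMascheroniConstant := by
  have hmono : MonotoneOn (fun k : ℕ => (harmonic k : ℝ) - Real.log k - 1 / (2 * k))
      (Set.Ici 1) := monotoneOn_nat_Ici_of_le_succ fun k hk => by
    have hinv : ((k + 1 : ℕ) : ℝ)⁻¹ = 2 * (1 / (2 * (k + 1 : ℕ))) := by field_simp
    have := log_succ_sub_log_le hk
    simp only [harmonic_succ, Rat.cast_add, Rat.cast_inv, Rat.cast_natCast]
    linarith
  refine ge_of_tendsto Real.tendsto_harmonic_sub_log ?_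
  filter_upwards [eventually_ge_atTop n] with k hk
  have hle := hmono hn (hn.trans hk) hk
  have hpos : (0 : ℝ) ≤ 1 / (2 * k) := by positivity
  simp only at hle
  linarith

theorem lt_eulerMascheroniConstant : (0.577 : ℝ) < Real.eulerMascheroniConstant := by
  have hbound := harmonic_sub_log_sub_le_eulerMascheroniConstant (n := 32) (by norm_num)
  have hlog : Real.log (32 : ℕ) = 5 * Real.log 2 := by
    rw [show ((32 : ℕ) : ℝ) = 2 ^ 5 by norm_num, Real.log_pow]
    norm_num
  have hharmonic : (4.0584 : ℝ) < (harmonic 32 : ℝ) := by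
    have : (4.0584 : ℚ) < harmonic 32 := by norm_num [harmonic, Finset.sum_range_succ]
    calc (4.0584 : ℝ) = ((4.0584 : ℚ) : ℝ) := by norm_num
      _ < _ := by exact_mod_cast this
  have hlog_two := Real.log_two_lt_d9
  rw [hlog] at hbound
  norm_num at hbound hharmonic hlog_two ⊢
  linarith

theorem lt_exp_eulerMascheroniConstant_div_two :
    (0.89 : ℝ) < Real.exp Real.eulerMascheroniConstant / 2 := by
  have hexp : (1.78 : ℝ) < Real.exp 0.577 :=
    lt_of_lt_of_le (by norm_num [Finset.sum_range_succ, Nat.factorial])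
      (Real.sum_le_exp_of_nonneg (x := 0.577) (by norm_num) 8)
  linarith [Real.exp_le_exp.2 lt_eulerMascheroniConstant.le]

theorem totient_primorial_mul_exp_eulerProductLog (X : ℕ) :
    ((primorial X).totient : ℝ) * Real.exp (eulerProductLog X) = primorial X := by
  have htotient : ((primorial X).totient : ℝ) =
      primorial X * ∏ p ∈ Nat.primesLE X, (1 - 1 / (p : ℝ)) := by
    have h := congrArg (Rat.cast : ℚ → ℝ) (Nat.totient_eq_mul_prod_factors (primorial X))
    rw [primeFactors_primorial] at h
    push_cast at h
    simpa only [one_div] using h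
  rw [htotient, eulerProductLog, Real.exp_sum, mul_assoc, ← Finset.prod_mul_distrib,
    Finset.prod_eq_one, mul_one]
  intro p hp
  have hfactor := one_sub_one_div_pos (Nat.two_le_of_mem_primesLE hp)
  rw [eulerFactorLog, Real.exp_neg, Real.exp_log hfactor, mul_inv_cancel₀ hfactor.ne']

theorem log_log_two_mul_totient_primorial_le (X : ℕ) :
    Real.log (Real.log (2 * (primorial X).totient : ℕ)) ≤ Real.log (X + 1) + 1 := by
  have htotient : 1 ≤ (primorial X).totient := Nat.totient_pos.2 (primorial_pos X)
  have hle : 2 * (primorial X).totient ≤ 4 ^ (X + 1) := by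
    have h1 := Nat.totient_le (primorial X)
    have h2 := primorial_le_four_pow X
    rw [pow_succ]
    omega
  have hlog : Real.log (2 * (primorial X).totient : ℕ) ≤ (X + 1) * Real.log 4 := by
    have h := Real.log_le_log (x := ((2 * (primorial X).totient : ℕ) : ℝ)) (by positivity)
      (by exact_mod_cast hle : _ ≤ (4 : ℝ) ^ (X + 1))
    rwa [Real.log_pow, Nat.cast_add_one] at h
  have hpos : 0 < Real.log (2 * (primorial X).totient : ℕ) :=
    Real.log_pos (by exact_mod_cast (by omega : 1 < 2 * (primorial X).totient))
  have hlog_four : 0 < Real.log 4 := Real.log_pos (by norm_num)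
  calc Real.log (Real.log (2 * (primorial X).totient : ℕ))
      ≤ Real.log ((X + 1) * Real.log 4) := Real.log_le_log hpos hlog
    _ = Real.log (X + 1) + Real.log (Real.log 4) :=
      Real.log_mul (by positivity) hlog_four.ne'
    _ ≤ Real.log (X + 1) + 1 := by
      linarith [Real.log_le_sub_one_of_pos hlog_four, log_four_le_two]

theorem tendsto_totient_primorial : Tendsto (fun X => (primorial X).totient) atTop atTop := by
  refine tendsto_atTop.2 fun N => ?_
  obtain ⟨p, hNp, hp⟩ := Nat.exists_infinite_primes (N + 1)
  filter_upwards [eventually_ge_atTop p] with X hX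
  have hdvd : p ∣ primorial X := Finset.dvd_prod_of_mem _ (Nat.mem_primesLE.2 ⟨hX, hp⟩)
  calc N ≤ p - 1 := Nat.le_sub_one_of_lt hNp
    _ = p.totient := (Nat.totient_prime hp).symm
    _ ≤ (primorial X).totient :=
      Nat.le_of_dvd (Nat.totient_pos.2 (primorial_pos X)) (Nat.totient_dvd_of_dvd hdvd)

theorem eventually_log_log_two_mul_totient_primorial_nonneg : ∀ᶠ X : ℕ in atTop,
    0 ≤ Real.log (Real.log (2 * (primorial X).totient : ℕ)) := by
  filter_upwards [tendsto_totient_primorial.eventually_ge_atTop 2] with X hX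
  have hX' : (3 : ℝ) ≤ (2 * (primorial X).totient : ℕ) := by
    exact_mod_cast (by omega : 3 ≤ 2 * (primorial X).totient)
  refine Real.log_nonneg ?_
  rw [Real.le_log_iff_exp_le (by linarith)]
  linarith [Real.exp_one_lt_three]

theorem eventually_mul_log_log_mul_totient_primorial_le {c : ℝ}
    (hc : c < Real.exp Real.eulerMascheroniConstant) : ∀ᶠ X : ℕ in atTop,
    c * Real.log (Real.log (2 * (primorial X).totient : ℕ)) * (primorial X).totient ≤
      primorial X := by
  obtain ⟨c', hcc', hc'⟩ := exists_between (max_lt hc (Real.exp_pos _))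
  have hlog : Tendsto (fun X : ℕ => (c' - max c 0) * Real.log X) atTop atTop :=
    (Real.tendsto_log_atTop.comp tendsto_natCast_atTop_atTop).const_mul_atTop (sub_pos.2 hcc')
  filter_upwards [eventually_mul_log_le_exp_eulerProductLog hc', eventually_ge_atTop 1,
    eventually_log_log_two_mul_totient_primorial_nonneg,
    hlog.eventually_ge_atTop (max c 0 * 2)] with X hexp hX hnonneg hlarge
  have hX' : (1 : ℝ) ≤ X := by exact_mod_cast hX
  have hlog_succ : Real.log (X + 1) ≤ Real.log X + 1 := by
    have h := Real.log_le_log (by positivity) (by linarith : (X + 1 : ℝ) ≤ X * 2)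
    rw [Real.log_mul (by positivity) two_ne_zero] at h
    linarith [Real.log_two_lt_d9]
  rw [← totient_primorial_mul_exp_eulerProductLog, mul_comm]
  refine mul_le_mul_of_nonneg_left ?_ (Nat.cast_nonneg _)
  calc c * Real.log (Real.log (2 * (primorial X).totient : ℕ))
      ≤ max c 0 * Real.log (Real.log (2 * (primorial X).totient : ℕ)) :=
        mul_le_mul_of_nonneg_right (le_max_left _ _) hnonneg
    _ ≤ max c 0 * (Real.log X + 2) := mul_le_mul_of_nonneg_left
        (by linarith [log_log_two_mul_totient_primorial_le X]) (le_max_right _ _)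
    _ ≤ c' * Real.log X := by linarith
    _ ≤ Real.exp (eulerProductLog X) := hexp

end Mertens

/-! ### Density of Euclidean lattices -/

section LatticeGeometry

variable {E : Type*} [NormedAddCommGroup E]

theorem le_latticeMinimum {L : Submodule ℤ E} (hL : L ≠ ⊥) {r : ℝ}
    (h : ∀ x ∈ L, x ≠ 0 → r ≤ ‖x‖) : r ≤ latticeMinimum L := by
  obtain ⟨x, hx, hx0⟩ := Submodule.exists_mem_ne_zero_of_ne_bot hL
  refine le_csInf ⟨‖x‖, x, hx, hx0, rfl⟩ ?_
  rintro _ ⟨y, hy, hy0, rfl⟩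
  exact h y hy hy0

variable [InnerProductSpace ℝ E]

theorem exists_int_norm_add_smul_sq_le (w e : E) (t : ℝ) :
    ∃ k : ℤ, ‖w + (t - k) • e‖ ^ 2 ≤ ‖w‖ ^ 2 + 1 / 4 * ‖e‖ ^ 2 := by
  have expand (c : ℝ) :
      ‖w + c • e‖ ^ 2 = ‖w‖ ^ 2 + 2 * c * inner ℝ w e + c ^ 2 * ‖e‖ ^ 2 := by
    rw [norm_add_sq_real, norm_smul, inner_smul_right, mul_pow, Real.norm_eq_abs, sq_abs]
    ring
  by_contra! h
  have floor_lt := h ⌊t⌋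
  have ceil_lt := h (⌊t⌋ + 1)
  set f := Int.fract t with hf
  have hfloor : t - ⌊t⌋ = f := Int.self_sub_floor t
  have hceil : t - (⌊t⌋ + 1 : ℤ) = f - 1 := by push_cast; linarith
  rw [hfloor, expand] at floor_lt
  rw [hceil, expand] at ceil_lt
  -- Weighted by `1 - f` and `f`, the two squared norms average to `‖w‖² + f (1 - f) ‖e‖²`.
  have floor_le := mul_lt_mul_of_pos_left floor_lt (sub_pos.2 (Int.fract_lt_one t))
  have ceil_le := mul_le_mul_of_nonneg_left ceil_lt.le (Int.fract_nonneg t)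
  nlinarith [mul_nonneg (sq_nonneg ‖e‖) (sq_nonneg (2 * f - 1))]

theorem exists_mem_norm_sum_smul_sub_sq_le {ι : Type*} (L : Submodule ℤ E) {e : ι → E}
    (he : ∀ i, e i ∈ L) (t : ι → ℝ) (s : Finset ι) :
    ∃ x ∈ L, ‖∑ i ∈ s, t i • e i - x‖ ^ 2 ≤ 1 / 4 * ∑ i ∈ s, ‖e i‖ ^ 2 := by
  classical
  induction s using Finset.induction_on with
  | empty => exact ⟨0, L.zero_mem, by simp⟩
  | insert i s hi ih =>
    obtain ⟨x, hx, hle⟩ := ih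
    obtain ⟨k, hk⟩ := exists_int_norm_add_smul_sq_le (∑ i ∈ s, t i • e i - x) (e i) (t i)
    refine ⟨x + k • e i, L.add_mem hx (L.smul_mem k (he i)), ?_⟩
    have hsplit : t i • e i + ∑ i ∈ s, t i • e i - (x + k • e i) =
        ∑ i ∈ s, t i • e i - x + (t i - k) • e i := by
      rw [sub_smul, Int.cast_smul_eq_zsmul]
      abel
    rw [Finset.sum_insert hi, Finset.sum_insert hi, hsplit]
    linarith

theorem ne_bot_of_isZLattice [Nontrivial E] (L : Submodule ℤ E) [DiscreteTopology L]
    [IsZLattice ℝ L] : L ≠ ⊥ := by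
  rintro rfl
  simpa using IsZLattice.span_top (K := ℝ) (L := (⊥ : Submodule ℤ E))

open scoped Pointwise in
theorem mul_measure_fundamentalDomain_le {G α : Type*} [AddGroup G] [Countable G] [AddAction G α]
    [MeasurableSpace α] {μ : Measure α} [MeasurableConstVAdd G α] [VAddInvariantMeasure G α μ]
    {D B : Set α} (hD : IsAddFundamentalDomain G D μ) (hB : MeasurableSet B) {k : ℕ}
    (h : ∀ z, ∃ T : Finset G, T.card = k ∧ ∀ g ∈ T, z ∈ g +ᵥ B) :
    k * μ D ≤ μ B := by
  have htranslate (g : G) : μ ((g +ᵥ B) ∩ D) = ∫⁻ z in D, (g +ᵥ B).indicator 1 z ∂μ := by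
    rw [lintegral_indicator_one (hB.const_vadd g), Measure.restrict_apply (hB.const_vadd g)]
  calc (k : ENNReal) * μ D = ∫⁻ _ in D, k ∂μ := (setLIntegral_const D _).symm
    _ ≤ ∫⁻ z in D, ∑' g : G, (g +ᵥ B).indicator 1 z ∂μ := by
      refine lintegral_mono fun z => ?_
      obtain ⟨T, hT, hz⟩ := h z
      calc (k : ENNReal) = ∑ g ∈ T, (g +ᵥ B).indicator 1 z := by
            rw [Finset.sum_congr rfl fun g hg => Set.indicator_of_mem (hz g hg) 1]
            simp [hT]
        _ ≤ ∑' g : G, (g +ᵥ B).indicator 1 z := ENNReal.sum_le_tsum T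
    _ = ∑' g : G, μ ((g +ᵥ B) ∩ D) := by
      rw [lintegral_tsum fun g => (measurable_one.indicator (hB.const_vadd g)).aemeasurable]
      exact tsum_congr fun g => (htranslate g).symm
    _ = μ B := (hD.measure_eq_tsum B).symm

variable [FiniteDimensional ℝ E] [MeasurableSpace E] [BorelSpace E]

theorem card_mul_covolume_le (L : Submodule ℤ E) [DiscreteTopology L] [IsZLattice ℝ L] {τ r : ℝ}
    (hτ : ∀ z : E, ∃ x ∈ L, ‖z - x‖ ≤ τ) (S : Finset E) (hS : ∀ x ∈ S, x ∈ L ∧ ‖x‖ ≤ r) :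
    S.card * ZLattice.covolume L volume ≤
      (volume : Measure E).real (Metric.closedBall 0 (r + τ)) := by
  classical
  have := ZLattice.module_free ℝ L
  have := ZLattice.module_finite ℝ L
  have hD := ZLattice.isAddFundamentalDomain (Module.Free.chooseBasis ℤ L) (volume : Measure E)
  have : MeasurableVAdd L E := (inferInstance : MeasurableVAdd L.toAddSubgroup E)
  have : VAddInvariantMeasure L E (volume : Measure E) :=
    (inferInstance : VAddInvariantMeasure L.toAddSubgroup E volume)
  have hle := mul_measure_fundamentalDomain_le hD
    (Metric.isClosed_closedBall (x := (0 : E)) (ε := r + τ)).measurableSet (k := S.card)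
    fun z => by
      obtain ⟨x, hx, hxz⟩ := hτ z
      refine ⟨S.attach.image fun y : S => ⟨x + y, L.add_mem hx (hS y y.2).1⟩, ?_, fun g hg => ?_⟩
      · rw [Finset.card_image_of_injective, Finset.card_attach]
        exact fun y y' h => Subtype.ext (add_left_cancel (congrArg Subtype.val h))
      · obtain ⟨y, -, rfl⟩ := Finset.mem_image.1 hg
        rw [Set.mem_vadd_set_iff_neg_vadd_mem, mem_closedBall_zero_iff]
        calc ‖-(x + y) + z‖ = ‖z - x - y‖ := by congr 1; abel
          _ ≤ ‖z - x‖ + ‖(y : E)‖ := norm_sub_le _ _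
          _ ≤ r + τ := by linarith [(hS y y.2).2]
  rw [ZLattice.covolume_eq_measure_fundamentalDomain L volume hD]
  simpa [ENNReal.toReal_mul] using! ENNReal.toReal_mono measure_closedBall_lt_top.ne hle

theorem volume_closedBall_le_covolume [Nontrivial E] (L : Submodule ℤ E) [DiscreteTopology L]
    [IsZLattice ℝ L] {μ : ℝ} (hμ : ∀ x ∈ L, x ≠ 0 → μ ≤ ‖x‖) :
    (volume : Measure E).real (Metric.closedBall 0 μ) ≤
      2 ^ Module.finrank ℝ E * ZLattice.covolume L volume := by
  have := ZLattice.module_free ℝ L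
  have := ZLattice.module_finite ℝ L
  let b := Module.Free.chooseBasis ℤ L
  have hD := ZLattice.isAddFundamentalDomain b (volume : Measure E)
  rw [ZLattice.covolume_eq_measure_fundamentalDomain L volume hD,
    Measure.addHaar_real_closedBall_eq_addHaar_real_ball]
  by_contra! h
  have hDfin : volume (ZSpan.fundamentalDomain (b.ofZLatticeBasis ℝ)) ≠ ⊤ :=
    (ZSpan.fundamentalDomain_isBounded _).measure_lt_top.ne
  have : Countable L.toAddSubgroup := (inferInstance : Countable L)
  obtain ⟨x, hx0, hx⟩ := exists_ne_zero_mem_lattice_of_measure_mul_two_pow_lt_measure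
    (L := L.toAddSubgroup) (s := Metric.ball (0 : E) μ) hD
    (fun x hx => by simpa using hx) (convex_ball _ _) (by
      rw [← ENNReal.toReal_lt_toReal (ENNReal.mul_ne_top hDfin (by simp)) measure_ball_lt_top.ne]
      simpa [ENNReal.toReal_mul, mul_comm] using! h)
  exact (mem_ball_zero_iff.1 hx).not_ge (hμ x x.2 (by simpa using hx0))

theorem div_covolume_le_latticeDensity [Nontrivial E] (L : Submodule ℤ E) [DiscreteTopology L]
    [IsZLattice ℝ L] {r : ℝ} (hr : ∀ x ∈ L, x ≠ 0 → r ≤ ‖x‖) :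
    (volume : Measure E).real (Metric.closedBall 0 r) /
      (2 ^ Module.finrank ℝ E * ZLattice.covolume L volume) ≤ latticeDensity L := by
  have := ZLattice.covolume_pos L (volume : Measure E)
  refine div_le_div_of_nonneg_right ?_ (by positivity)
  exact measureReal_mono
    (Metric.closedBall_subset_closedBall (le_latticeMinimum (ne_bot_of_isZLattice L) hr))
    measure_closedBall_lt_top.ne

theorem exists_forall_le_norm {ι : Type*} [Fintype ι] (L₀ : Submodule ℤ E)
    [DiscreteTopology L₀] [IsZLattice ℝ L₀] (L : ι → Submodule ℤ E) (hL : ∀ i, L i ≤ L₀) {m : ℕ}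
    (horbit : ∀ i, ∀ x ∈ L i, x ≠ 0 →
      ∃ T : Finset E, T.card = m ∧ ∀ y ∈ T, y ∈ L i ∧ ‖y‖ = ‖x‖)
    {r τ : ℝ} (hτ : ∀ z : E, ∃ x ∈ L₀, ‖z - x‖ ≤ τ)
    (hinter : Pairwise fun i j => ∀ x ∈ L i ⊓ L j, x ≠ 0 → r ≤ ‖x‖)
    (hvol : (volume : Measure E).real (Metric.closedBall 0 (r + τ)) <
      m * (Fintype.card ι * ZLattice.covolume L₀ volume)) :
    ∃ i, ∀ x ∈ L i, x ≠ 0 → r ≤ ‖x‖ := by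
  classical
  by_contra! hshort
  choose x hxL hx0 hxr using hshort
  choose T hTm hT using fun i => horbit i (x i) (hxL i) (hx0 i)
  have hdisjoint (i j : ι) (hij : i ≠ j) : Disjoint (T i) (T j) := by
    refine Finset.disjoint_left.2 fun y hyi hyj => ?_
    have hy := (hT i y hyi).2
    have hy0 : y ≠ 0 := norm_ne_zero_iff.1 (hy ▸ norm_ne_zero_iff.2 (hx0 i))
    exact (hinter hij y ⟨(hT i y hyi).1, (hT j y hyj).1⟩ hy0).not_gt (hy ▸ hxr i)
  have hcard : (Finset.univ.biUnion T).card = m * Fintype.card ι := by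
    rw [Finset.card_biUnion fun i _ j _ => hdisjoint i j, Finset.sum_congr rfl fun i _ => hTm i]
    simp [mul_comm]
  have hcount := card_mul_covolume_le L₀ hτ (Finset.univ.biUnion T) (r := r) fun y hy => by
    obtain ⟨i, -, hy⟩ := Finset.mem_biUnion.1 hy
    exact ⟨hL i (hT i y hy).1, (hT i y hy).2.le.trans (hxr i).le⟩
  rw [hcard, Nat.cast_mul, mul_assoc] at hcount
  exact hvol.not_ge hcount

theorem volume_closedBall_mul {c r : ℝ} (hc : 0 ≤ c) (hr : 0 ≤ r) :
    (volume : Measure E).real (Metric.closedBall 0 (c * r)) =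
      c ^ Module.finrank ℝ E * (volume : Measure E).real (Metric.closedBall 0 r) := by
  rw [Measure.addHaar_real_closedBall _ _ (mul_nonneg hc hr),
    Measure.addHaar_real_closedBall _ _ hr, mul_pow, mul_assoc]

theorem volume_closedBall_le_iff [Nontrivial E] {r s : ℝ} (hr : 0 ≤ r) (hs : 0 ≤ s) :
    (volume : Measure E).real (Metric.closedBall 0 r) ≤
      (volume : Measure E).real (Metric.closedBall 0 s) ↔ r ≤ s := by
  have hpos : 0 < (volume : Measure E).real (Metric.ball 0 1) :=
    ENNReal.toReal_pos (Metric.measure_ball_pos _ _ one_pos).ne' measure_ball_lt_top.ne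
  rw [Measure.addHaar_real_closedBall _ _ hr, Measure.addHaar_real_closedBall _ _ hs,
    mul_le_mul_iff_left₀ hpos, pow_le_pow_iff_left₀ hr hs Module.finrank_pos.ne']

theorem exists_volume_closedBall_eq [Nontrivial E] {a : ℝ} (ha : 0 ≤ a) :
    ∃ r, 0 ≤ r ∧ (volume : Measure E).real (Metric.closedBall 0 r) = a := by
  have hpos : 0 < (volume : Measure E).real (Metric.ball 0 1) :=
    ENNReal.toReal_pos (Metric.measure_ball_pos _ _ one_pos).ne' measure_ball_lt_top.ne
  set v := (volume : Measure E).real (Metric.ball 0 1)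
  refine ⟨(a / v) ^ (Module.finrank ℝ E : ℝ)⁻¹, by positivity, ?_⟩
  rw [Measure.addHaar_real_closedBall _ _ (by positivity),
    Real.rpow_inv_natCast_pow (by positivity) Module.finrank_pos.ne', div_mul_cancel₀ a hpos.ne']

theorem volume_closedBall_add_le [Nontrivial E] {r τ ε : ℝ} (hr : 0 ≤ r) (hτ : 0 ≤ τ)
    (h : Module.finrank ℝ E * τ ≤ ε * r) :
    (volume : Measure E).real (Metric.closedBall 0 (r + τ)) ≤
      Real.exp ε * (volume : Measure E).real (Metric.closedBall 0 r) := by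
  have hn : (0 : ℝ) < Module.finrank ℝ E := by exact_mod_cast Module.finrank_pos
  have hadd : r + τ ≤ Real.exp (ε / Module.finrank ℝ E) * r := by
    have hτr : τ ≤ ε / Module.finrank ℝ E * r := by
      rw [div_mul_eq_mul_div, le_div_iff₀ hn]
      linarith
    linarith [mul_le_mul_of_nonneg_right (Real.add_one_le_exp (ε / Module.finrank ℝ E)) hr]
  calc (volume : Measure E).real (Metric.closedBall 0 (r + τ))
      ≤ (volume : Measure E).real
          (Metric.closedBall 0 (Real.exp (ε / Module.finrank ℝ E) * r)) :=
        (volume_closedBall_le_iff (add_nonneg hr hτ) (by positivity)).2 hadd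
    _ = Real.exp ε * (volume : Measure E).real (Metric.closedBall 0 r) := by
        rw [volume_closedBall_mul (by positivity) hr, ← Real.exp_nat_mul,
          mul_div_cancel₀ ε hn.ne']

theorem exists_volume_closedBall_eq_mul_covolume [Nontrivial E] (L : Submodule ℤ E)
    [DiscreteTopology L] [IsZLattice ℝ L] {μ τ t R a : ℝ} (hμ0 : 0 ≤ μ)
    (hμ : ∀ x ∈ L, x ≠ 0 → μ ≤ ‖x‖) (hτ : ∀ z : E, ∃ x ∈ L, ‖z - x‖ ≤ τ)
    (ht0 : 0 ≤ t) (ht : t ^ Module.finrank ℝ E ≤ a) (hR0 : 0 ≤ R)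
    (hR : a * τ ^ Module.finrank ℝ E ≤ R ^ Module.finrank ℝ E) :
    ∃ r, t / 2 * μ ≤ r ∧ r ≤ R ∧
      (volume : Measure E).real (Metric.closedBall 0 r) = a * ZLattice.covolume L volume := by
  set n := Module.finrank ℝ E with hn
  set vol : ℝ → ℝ := fun r => (volume : Measure E).real (Metric.closedBall 0 r) with hvol
  set V := ZLattice.covolume L volume
  have hV0 : 0 < V := ZLattice.covolume_pos L volume
  have ha0 : 0 ≤ a := (pow_nonneg ht0 n).trans ht
  have hτ0 : 0 ≤ τ := (norm_nonneg _).trans (hτ 0).choose_spec.2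
  obtain ⟨r, hr0, hr⟩ := exists_volume_closedBall_eq (E := E) (mul_nonneg ha0 hV0.le)
  refine ⟨r, ?_, ?_, hr⟩
  · rw [← volume_closedBall_le_iff (E := E) (by positivity) hr0, hr,
      volume_closedBall_mul (by positivity) hμ0, div_pow, ← hn]
    calc t ^ n / 2 ^ n * vol μ ≤ t ^ n / 2 ^ n * (2 ^ n * V) := by
          gcongr; exact volume_closedBall_le_covolume L hμ
      _ = t ^ n * V := by field_simp
      _ ≤ a * V := by gcongr
  · rw [← volume_closedBall_le_iff (E := E) hr0 hR0, hr]
    have hVτ : V ≤ vol τ := by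
      simpa [hvol] using card_mul_covolume_le L hτ {0} (r := 0) (by simp)
    calc a * V ≤ a * vol τ := by gcongr
      _ ≤ vol R := by
        simp only [hvol, Measure.addHaar_real_closedBall _ _ hR0,
          Measure.addHaar_real_closedBall _ _ hτ0, ← hn, ← mul_assoc]
        gcongr

theorem exists_latticeDensity_ge [Nontrivial E] {ι : Type*} [Fintype ι] [Nonempty ι]
    (L₀ : Submodule ℤ E) [DiscreteTopology L₀] [IsZLattice ℝ L₀] (L : ι → Submodule ℤ E)
    (hL : ∀ i, L i ≤ L₀) [∀ i, DiscreteTopology (L i)] [∀ i, IsZLattice ℝ (L i)]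
    (hindex : ∀ i, (L i).toAddSubgroup.relIndex L₀.toAddSubgroup = Fintype.card ι) {m : ℕ}
    (horbit : ∀ i, ∀ x ∈ L i, x ≠ 0 →
      ∃ T : Finset E, T.card = m ∧ ∀ y ∈ T, y ∈ L i ∧ ‖y‖ = ‖x‖)
    {μ τ R t ε : ℝ} (hμ0 : 0 ≤ μ) (hμ : ∀ x ∈ L₀, x ≠ 0 → μ ≤ ‖x‖)
    (hτ : ∀ z : E, ∃ x ∈ L₀, ‖z - x‖ ≤ τ)
    (hR0 : 0 ≤ R) (hR : Pairwise fun i j => ∀ x ∈ L i ⊓ L j, x ≠ 0 → R ≤ ‖x‖)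
    (ht0 : 0 ≤ t) (ht : t ^ Module.finrank ℝ E = Fintype.card ι)
    (hε : 0 < ε) (hm : 1 ≤ (1 - ε) * m)
    (hτμ : 2 * Module.finrank ℝ E * τ ≤ ε * (t * μ))
    (hτR : m * Fintype.card ι * τ ^ Module.finrank ℝ E ≤ R ^ Module.finrank ℝ E) :
    ∃ i, (1 - ε) * m / 2 ^ Module.finrank ℝ E ≤ latticeDensity (L i) := by
  set q := (Fintype.card ι : ℝ) with hq
  set V := ZLattice.covolume L₀ volume with hV
  have hV0 : 0 < V := ZLattice.covolume_pos L₀ volume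
  have hq0 : 0 < q := Nat.cast_pos.2 Fintype.card_pos
  have hm0 : (0 : ℝ) < m := m.cast_nonneg.lt_of_ne' (by rintro h; norm_num [h] at hm)
  have hτ0 : 0 ≤ τ := (norm_nonneg _).trans (hτ 0).choose_spec.2
  obtain ⟨r, htr, hrR, hr⟩ := exists_volume_closedBall_eq_mul_covolume L₀
    (a := (1 - ε) * m * q) hμ0 hμ hτ ht0
    (by rw [ht]; exact le_mul_of_one_le_left hq0.le hm) hR0
    (hτR.trans' (by gcongr; nlinarith))
  have hr0 : 0 ≤ r := htr.trans' (by positivity)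
  have hexp : Real.exp ε * (1 - ε) < 1 := by
    rw [← lt_div_iff₀' (Real.exp_pos ε), one_div, ← Real.exp_neg]
    linarith [Real.add_one_lt_exp (x := -ε) (by linarith)]
  have hvol : (volume : Measure E).real (Metric.closedBall 0 (r + τ)) < m * (q * V) :=
    calc (volume : Measure E).real (Metric.closedBall 0 (r + τ))
        ≤ Real.exp ε * (volume : Measure E).real (Metric.closedBall 0 r) :=
          volume_closedBall_add_le hr0 hτ0 (by nlinarith)
      _ = Real.exp ε * (1 - ε) * (m * (q * V)) := by rw [hr]; ring
      _ < m * (q * V) := mul_lt_of_lt_one_left (by positivity) hexp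
  obtain ⟨i, hi⟩ := exists_forall_le_norm L₀ L hL horbit hτ
    (fun i j hij x hx hx0 => hrR.trans (hR hij x hx hx0)) hvol
  have hcov := ZLattice.covolume_div_covolume_eq_relIndex' (L i) L₀ (hL i)
  rw [hindex, div_eq_iff hV0.ne', ← hq] at hcov
  refine ⟨i, le_trans (le_of_eq ?_) (div_covolume_le_latticeDensity (L i) hi)⟩
  rw [hr, hcov, ← hV]
  field_simp

end LatticeGeometry

/-! ### Cyclotomic integers -/

section CyclotomicGeometry

-- The inequality of the arithmetic and geometric means for the numbers `‖φ x‖²`.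
theorem finrank_mul_abs_norm_rpow_le_sum_norm_sq {K : Type*} [Field K] [NumberField K] (x : K) :
    Module.finrank ℚ K * |(Algebra.norm ℚ x : ℝ)| ^ (2 / (Module.finrank ℚ K : ℝ)) ≤
      ∑ φ : K →+* ℂ, ‖φ x‖ ^ 2 := by
  have hcard : Fintype.card (K →+* ℂ) = Module.finrank ℚ K := Embeddings.card K ℂ
  have hn : (0 : ℝ) < Module.finrank ℚ K := by exact_mod_cast Module.finrank_pos
  have hprod : ∏ φ : K →+* ℂ, ‖φ x‖ = |(Algebra.norm ℚ x : ℝ)| := by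
    have h := congrArg norm (Algebra.norm_eq_prod_embeddings ℚ ℂ x)
    rw [norm_prod] at h
    rw [Fintype.prod_equiv (RingHom.equivRatAlgHom K ℂ) (fun φ => ‖φ x‖) (fun σ => ‖σ x‖)
      fun _ => rfl, ← h]
    simp
  have hmean := Real.geom_mean_le_arith_mean Finset.univ (fun _ : K →+* ℂ => 1)
    (fun φ => ‖φ x‖ ^ 2) (fun _ _ => zero_le_one) (by simp [hcard, Module.finrank_pos])
    (fun _ _ => sq_nonneg _)
  simp only [Real.rpow_one, one_mul, Finset.sum_const, Finset.card_univ, hcard, nsmul_one,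
    Finset.prod_pow, hprod] at hmean
  rwa [le_div_iff₀' hn, ← Real.rpow_natCast, ← Real.rpow_mul (abs_nonneg _), Nat.cast_ofNat,
    ← div_eq_mul_inv] at hmean

theorem card_quotient_le_natAbs_norm {K : Type*} [Field K] [NumberField K] {P : Ideal (𝓞 K)}
    {k : 𝓞 K} (hk : k ∈ P) (hk0 : k ≠ 0) :
    Nat.card (𝓞 K ⧸ P) ≤ (Algebra.norm ℤ k).natAbs := by
  rw [← Submodule.cardQuot_apply, ← Ideal.absNorm_apply]
  exact Nat.le_of_dvd (Int.natAbs_pos.2 (Algebra.norm_ne_zero_iff.2 hk0))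
    (Int.natCast_dvd.1 (Ideal.absNorm_dvd_norm_of_mem hk))

variable (m : ℕ) [NeZero m]

theorem finrank_cyclotomicField : Module.finrank ℚ (CyclotomicField m ℚ) = m.totient :=
  IsCyclotomicExtension.finrank _ (Polynomial.cyclotomic.irreducible_rat (NeZero.pos m))

namespace CyclotomicRealSpace

theorem extendEmbedding_of (φ : CyclotomicField m ℚ →+* ℂ) (k : CyclotomicField m ℚ) :
    extendEmbedding m φ (of m k) = φ k :=
  (extendEmbedding_tmul m φ 1 k).trans (by simp)

theorem norm_sq_of (k : CyclotomicField m ℚ) :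
    ‖of m k‖ ^ 2 = ∑ φ : CyclotomicField m ℚ →+* ℂ, ‖φ k‖ ^ 2 := by
  rw [← real_inner_self_eq_norm_sq]
  refine (traceForm_self m (of m k)).trans ?_
  simp_rw [extendEmbedding_of]

theorem of_injective : Function.Injective (of m) := fun x y h => by
  let φ : CyclotomicField m ℚ →+* ℂ := Classical.arbitrary _
  apply φ.injective
  rw [← extendEmbedding_of, h, extendEmbedding_of]

theorem totient_mul_natAbs_norm_rpow_le_norm_sq_of (k : 𝓞 (CyclotomicField m ℚ)) :
    m.totient * ((Algebra.norm ℤ k).natAbs : ℝ) ^ (2 / (m.totient : ℝ)) ≤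
      ‖of m (k : CyclotomicField m ℚ)‖ ^ 2 := by
  have h := finrank_mul_abs_norm_rpow_le_sum_norm_sq (k : CyclotomicField m ℚ)
  rw [finrank_cyclotomicField, ← norm_sq_of, ← Algebra.coe_norm_int k] at h
  simpa [Nat.cast_natAbs] using h

theorem norm_sq_of_mul_of_pow_eq_one {ζ : 𝓞 (CyclotomicField m ℚ)} {n : ℕ} (hn : n ≠ 0)
    (hζ : ζ ^ n = 1) (k : 𝓞 (CyclotomicField m ℚ)) :
    ‖of m ((ζ * k : 𝓞 (CyclotomicField m ℚ)) : CyclotomicField m ℚ)‖ ^ 2 =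
      ‖of m (k : CyclotomicField m ℚ)‖ ^ 2 := by
  rw [norm_sq_of, norm_sq_of]
  refine Finset.sum_congr rfl fun φ _ => ?_
  have hφ : ‖φ ζ‖ = 1 :=
    Complex.norm_eq_one_of_pow_eq_one (by rw [← map_pow, ← map_pow, hζ, map_one, map_one]) hn
  have hmul : φ ((ζ * k : 𝓞 (CyclotomicField m ℚ)) : CyclotomicField m ℚ) = φ ζ * φ k :=
    map_mul φ (ζ : CyclotomicField m ℚ) k
  rw [hmul, norm_mul, hφ, one_mul]

theorem norm_sq_of_of_pow_eq_one {ζ : 𝓞 (CyclotomicField m ℚ)} {n : ℕ} (hn : n ≠ 0)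
    (hζ : ζ ^ n = 1) : ‖of m (ζ : CyclotomicField m ℚ)‖ ^ 2 = m.totient := by
  have h := norm_sq_of_mul_of_pow_eq_one m hn hζ 1
  rw [mul_one] at h
  rw [h, norm_sq_of, ← finrank_cyclotomicField, ← Embeddings.card (CyclotomicField m ℚ) ℂ]
  simp

end CyclotomicRealSpace

open CyclotomicRealSpace

/-- A primitive `m`-th root of unity in `ℤ[ζ_m]`. -/
noncomputable def integerZeta : 𝓞 (CyclotomicField m ℚ) :=
  (IsCyclotomicExtension.zeta_spec m ℚ (CyclotomicField m ℚ)).toInteger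

theorem integerZeta_isPrimitiveRoot : IsPrimitiveRoot (integerZeta m) m :=
  (IsCyclotomicExtension.zeta_spec m ℚ (CyclotomicField m ℚ)).toInteger_isPrimitiveRoot

theorem integerZeta_pow_pow_eq_one (i : ℕ) : (integerZeta m ^ i) ^ m = 1 := by
  rw [pow_right_comm, (integerZeta_isPrimitiveRoot m).pow_eq_one, one_pow]

theorem exists_basis_eq_of_integerZeta_pow :
    ∃ b : Module.Basis (Fin m.totient) ℝ (CyclotomicRealSpace m),
      ∀ i, b i = of m
        ((integerZeta m ^ (i : ℕ) : 𝓞 (CyclotomicField m ℚ)) : CyclotomicField m ℚ) := by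
  let pb := (IsCyclotomicExtension.zeta_spec m ℚ (CyclotomicField m ℚ)).powerBasis ℚ
  have hdim : pb.dim = m.totient := by rw [← pb.finrank, finrank_cyclotomicField]
  let c := pb.basis.reindex (finCongr hdim)
  refine ⟨Algebra.TensorProduct.basis ℝ c, fun i => ?_⟩
  refine (Algebra.TensorProduct.basis_apply c i).trans (congrArg (of m) ?_)
  simp [c, pb, integerZeta]
  rfl

/-- The embedding of `ℤ[ζ_m]²` into the Euclidean space `E = (ℚ(ζ_m) ⊗ ℝ)²`. -/
noncomputable def integerPlaneHom : (Fin 2 → 𝓞 (CyclotomicField m ℚ)) →+ CyclotomicPlane m where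
  toFun a := WithLp.toLp 2 fun i => of m (a i : CyclotomicField m ℚ)
  map_zero' := by ext i; simp
  map_add' a b := by ext i; simp

theorem integerPlaneHom_apply (a : Fin 2 → 𝓞 (CyclotomicField m ℚ)) (i : Fin 2) :
    integerPlaneHom m a i = of m (a i : CyclotomicField m ℚ) := rfl

theorem integerPlaneHom_injective : Function.Injective (integerPlaneHom m) := fun a b h => by
  funext i
  exact RingOfIntegers.ext (of_injective m (congrArg (fun v : CyclotomicPlane m => v i) h))

theorem norm_sq_integerPlaneHom (a : Fin 2 → 𝓞 (CyclotomicField m ℚ)) :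
    ‖integerPlaneHom m a‖ ^ 2 = ∑ i, ‖of m (a i : CyclotomicField m ℚ)‖ ^ 2 :=
  PiLp.norm_sq_eq_of_L2 _ _

theorem totient_mul_rpow_le_norm_sq_integerPlaneHom {a : Fin 2 → 𝓞 (CyclotomicField m ℚ)}
    (ha : a ≠ 0) {q : ℕ} (h : ∀ i, a i ≠ 0 → q ≤ (Algebra.norm ℤ (a i)).natAbs) :
    m.totient * (q : ℝ) ^ (2 / (m.totient : ℝ)) ≤ ‖integerPlaneHom m a‖ ^ 2 := by
  obtain ⟨i, hi⟩ := Function.ne_iff.1 ha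
  calc m.totient * (q : ℝ) ^ (2 / (m.totient : ℝ))
      ≤ m.totient * ((Algebra.norm ℤ (a i)).natAbs : ℝ) ^ (2 / (m.totient : ℝ)) := by
        gcongr
        exact h i hi
    _ ≤ ‖of m (a i : CyclotomicField m ℚ)‖ ^ 2 :=
        totient_mul_natAbs_norm_rpow_le_norm_sq_of m (a i)
    _ ≤ ‖integerPlaneHom m a‖ ^ 2 := by
        rw [norm_sq_integerPlaneHom]
        exact Finset.single_le_sum (f := fun i => ‖of m (a i : CyclotomicField m ℚ)‖ ^ 2)
          (fun _ _ => sq_nonneg _) (Finset.mem_univ i)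

theorem norm_integerPlaneHom_integerZeta_pow_smul (i : ℕ)
    (a : Fin 2 → 𝓞 (CyclotomicField m ℚ)) :
    ‖integerPlaneHom m (integerZeta m ^ i • a)‖ = ‖integerPlaneHom m a‖ := by
  rw [← sq_eq_sq₀ (norm_nonneg _) (norm_nonneg _), norm_sq_integerPlaneHom,
    norm_sq_integerPlaneHom]
  exact Finset.sum_congr rfl fun j _ =>
    norm_sq_of_mul_of_pow_eq_one m (NeZero.ne m) (integerZeta_pow_pow_eq_one m i) (a j)

/-- The vectors of `ℤ[ζ_m]²` that have one coordinate a power of `ζ_m` and the other zero. They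
span `E` over `ℝ`. -/
noncomputable def zetaVector (ji : Fin 2 × Fin m.totient) : Fin 2 → 𝓞 (CyclotomicField m ℚ) :=
  Pi.single ji.1 (integerZeta m ^ (ji.2 : ℕ))

theorem norm_sq_integerPlaneHom_zetaVector (ji : Fin 2 × Fin m.totient) :
    ‖integerPlaneHom m (zetaVector m ji)‖ ^ 2 = m.totient := by
  rw [norm_sq_integerPlaneHom, Finset.sum_eq_single ji.1]
  · rw [zetaVector, Pi.single_eq_same,
      norm_sq_of_of_pow_eq_one m (NeZero.ne m) (integerZeta_pow_pow_eq_one m _)]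
  · intro j _ hj
    rw [zetaVector, Pi.single_eq_of_ne hj]
    simp
  · simp

theorem exists_eq_sum_smul_zetaVector (z : CyclotomicPlane m) :
    ∃ t : Fin 2 × Fin m.totient → ℝ, z = ∑ ji, t ji • integerPlaneHom m (zetaVector m ji) := by
  obtain ⟨b, hb⟩ := exists_basis_eq_of_integerZeta_pow m
  refine ⟨fun ji => b.repr (z ji.1) ji.2, ?_⟩
  ext j
  rw [WithLp.ofLp_sum, Finset.sum_apply, Fintype.sum_prod_type, Finset.sum_eq_single j]
  · conv_lhs => rw [← b.sum_repr (z j)]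
    refine Finset.sum_congr rfl fun i _ => ?_
    rw [PiLp.smul_apply, integerPlaneHom_apply, zetaVector, Pi.single_eq_same, hb]
  · intro j' _ hj
    refine Finset.sum_eq_zero fun i _ => ?_
    rw [PiLp.smul_apply, integerPlaneHom_apply, zetaVector, Pi.single_eq_of_ne hj.symm]
    simp
  · simp

end CyclotomicGeometry

section SlopeLines

variable {F : Type*} [CommRing F]

/-- The line of `F²` through `(1, c)`. -/
def slopeLine (c : F) : Submodule F (Fin 2 → F) :=
  Submodule.span F {![1, c]}

theorem mem_slopeLine {c : F} {w : Fin 2 → F} : w ∈ slopeLine c ↔ w 1 = c * w 0 := by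
  rw [slopeLine, Submodule.mem_span_singleton]
  constructor
  · rintro ⟨k, rfl⟩
    simp [mul_comm]
  · intro h
    refine ⟨w 0, ?_⟩
    ext i
    fin_cases i
    · simp
    · simp [h, mul_comm]

theorem finrank_slopeLine [Nontrivial F] (c : F) : Module.finrank F (slopeLine c) = 1 := by
  have hinj : Function.Injective (LinearMap.toSpanSingleton F (Fin 2 → F) ![1, c]) :=
    fun x y h => by simpa using congrFun h 0
  rw [slopeLine, ← LinearMap.range_toSpanSingleton, LinearMap.finrank_range_of_inj hinj,
    Module.finrank_self]

theorem slopeLine_inf_slopeLine [IsDomain F] {c c' : F} (h : c ≠ c') :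
    slopeLine c ⊓ slopeLine c' = ⊥ := by
  refine (Submodule.eq_bot_iff _).2 fun w ⟨hw, hw'⟩ => ?_
  rw [SetLike.mem_coe, mem_slopeLine] at hw hw'
  have hw0 : w 0 = 0 := mul_left_cancel₀ (sub_ne_zero.2 h) (by linear_combination hw' - hw)
  ext i
  fin_cases i
  · exact hw0
  · simpa [hw0] using hw

end SlopeLines

section CyclotomicLattices

variable {m : ℕ} [NeZero m] {P : Ideal (𝓞 (CyclotomicField m ℚ))}
  {C C' : Submodule (𝓞 (CyclotomicField m ℚ) ⧸ P) (Fin 2 → 𝓞 (CyclotomicField m ℚ) ⧸ P)}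

theorem mem_codeLattice {v : CyclotomicPlane m} : v ∈ codeLattice P C ↔
    ∃ a, (fun i => Ideal.Quotient.mk P (a i)) ∈ C ∧ v = integerPlaneHom m a := by
  refine exists_congr fun a => and_congr_right fun _ => ⟨fun h => ?_, fun h i => ?_⟩
  · ext i
    exact h i
  · rw [h, integerPlaneHom_apply]

theorem codeLattice_mono (h : C ≤ C') : codeLattice P C ≤ codeLattice P C' :=
  fun _ ⟨a, ha, hv⟩ => ⟨a, h ha, hv⟩

theorem codeLattice_inf : codeLattice P C ⊓ codeLattice P C' = codeLattice P (C ⊓ C') := by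
  refine le_antisymm (fun v ⟨hv, hv'⟩ => ?_)
    (le_inf (codeLattice_mono inf_le_left) (codeLattice_mono inf_le_right))
  obtain ⟨a, ha, rfl⟩ := mem_codeLattice.1 hv
  obtain ⟨a', ha', haa'⟩ := mem_codeLattice.1 hv'
  obtain rfl := integerPlaneHom_injective m haa'
  exact mem_codeLattice.2 ⟨a, ⟨ha, ha'⟩, rfl⟩

theorem totient_le_norm_sq_of_mem_codeLattice {v : CyclotomicPlane m} (hv : v ∈ codeLattice P C)
    (hv0 : v ≠ 0) : (m.totient : ℝ) ≤ ‖v‖ ^ 2 := by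
  obtain ⟨a, -, rfl⟩ := mem_codeLattice.1 hv
  have ha0 : a ≠ 0 := by
    rintro rfl
    exact hv0 (map_zero _)
  simpa using totient_mul_rpow_le_norm_sq_integerPlaneHom m ha0 (q := 1) fun i hi =>
    Int.natAbs_pos.2 (Algebra.norm_ne_zero_iff.2 hi)

theorem totient_mul_rpow_le_norm_sq_of_mem_codeLattice_bot {v : CyclotomicPlane m}
    (hv : v ∈ codeLattice P ⊥) (hv0 : v ≠ 0) :
    m.totient * (Nat.card (𝓞 (CyclotomicField m ℚ) ⧸ P) : ℝ) ^ (2 / (m.totient : ℝ)) ≤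
      ‖v‖ ^ 2 := by
  obtain ⟨a, ha, rfl⟩ := mem_codeLattice.1 hv
  refine totient_mul_rpow_le_norm_sq_integerPlaneHom m ?_ fun i hi =>
    card_quotient_le_natAbs_norm (Ideal.Quotient.eq_zero_iff_mem.1 (congrFun ha i)) hi
  rintro rfl
  exact hv0 (map_zero _)

instance discreteTopology_codeLattice : DiscreteTopology (codeLattice P C) := by
  refine DiscreteTopology.of_forall_le_dist (r := 1) one_pos fun x y hxy => ?_
  have hsub : (x : CyclotomicPlane m) - y ≠ 0 := sub_ne_zero.2 (Subtype.coe_ne_coe.2 hxy)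
  have htotient : (1 : ℝ) ≤ m.totient := by exact_mod_cast Nat.totient_pos.2 (NeZero.pos m)
  have hle := htotient.trans (totient_le_norm_sq_of_mem_codeLattice (x - y).2 hsub)
  change 1 ≤ dist x y
  rw [Subtype.dist_eq, dist_eq_norm]
  exact (one_le_sq_iff₀ (norm_nonneg _)).1 hle

theorem isZLattice_codeLattice (hP : P ≠ ⊥)
    (C : Submodule (𝓞 (CyclotomicField m ℚ) ⧸ P) (Fin 2 → 𝓞 (CyclotomicField m ℚ) ⧸ P)) :
    IsZLattice ℝ (codeLattice P C) := by
  set p := Ideal.absNorm P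
  have hp : (p : ℝ) ≠ 0 := Nat.cast_ne_zero.2 (Ideal.absNorm_eq_zero_iff.not.2 hP)
  refine ⟨eq_top_iff.2 fun z _ => ?_⟩
  obtain ⟨t, rfl⟩ := exists_eq_sum_smul_zetaVector m z
  refine Submodule.sum_mem _ fun ji _ => Submodule.smul_mem _ _ ?_
  rw [← inv_smul_smul₀ hp (integerPlaneHom m (zetaVector m ji))]
  refine Submodule.smul_mem _ _ (Submodule.subset_span
    (mem_codeLattice.2 ⟨p • zetaVector m ji, ?_, ?_⟩))
  · convert! C.zero_mem using 1
    funext i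
    rw [Pi.smul_apply, nsmul_eq_mul, Pi.zero_apply, Ideal.Quotient.eq_zero_iff_mem]
    exact P.mul_mem_right _ (Ideal.absNorm_mem P)
  · rw [map_nsmul, Nat.cast_smul_eq_nsmul]

theorem exists_mem_codeLattice_top_norm_sub_sq_le (P : Ideal (𝓞 (CyclotomicField m ℚ)))
    (z : CyclotomicPlane m) :
    ∃ x ∈ codeLattice P ⊤, ‖z - x‖ ^ 2 ≤ (m.totient : ℝ) ^ 2 / 2 := by
  obtain ⟨t, rfl⟩ := exists_eq_sum_smul_zetaVector m z
  obtain ⟨x, hx, h⟩ := exists_mem_norm_sum_smul_sub_sq_le (codeLattice P ⊤)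
    (e := fun ji => integerPlaneHom m (zetaVector m ji))
    (fun ji => mem_codeLattice.2 ⟨_, Submodule.mem_top, rfl⟩) t Finset.univ
  refine ⟨x, hx, h.trans (le_of_eq ?_)⟩
  simp only [norm_sq_integerPlaneHom_zetaVector, Finset.sum_const, Finset.card_univ,
    Fintype.card_prod, Fintype.card_fin, nsmul_eq_mul, Nat.cast_mul]
  ring

theorem exists_finset_card_eq_of_mem_codeLattice {v : CyclotomicPlane m}
    (hv : v ∈ codeLattice P C) (hv0 : v ≠ 0) :
    ∃ T : Finset (CyclotomicPlane m), T.card = m ∧ ∀ y ∈ T, y ∈ codeLattice P C ∧ ‖y‖ = ‖v‖ := by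
  classical
  obtain ⟨a, ha, rfl⟩ := mem_codeLattice.1 hv
  have ha0 : a ≠ 0 := by
    rintro rfl
    exact hv0 (map_zero _)
  obtain ⟨j, hj⟩ := Function.ne_iff.1 ha0
  refine ⟨(Finset.range m).image fun i => integerPlaneHom m (integerZeta m ^ i • a), ?_, ?_⟩
  · rw [Finset.card_image_of_injOn, Finset.card_range]
    intro i hi i' hi' h
    have hzeta := mul_right_cancel₀ hj (congrFun (integerPlaneHom_injective m h) j)
    exact (integerZeta_isPrimitiveRoot m).pow_inj (Finset.mem_range.1 hi)
      (Finset.mem_range.1 hi') hzeta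
  · intro y hy
    obtain ⟨i, -, rfl⟩ := Finset.mem_image.1 hy
    refine ⟨mem_codeLattice.2 ⟨_, ?_, rfl⟩, norm_integerPlaneHom_integerZeta_pow_smul m i a⟩
    convert! C.smul_mem (Ideal.Quotient.mk P (integerZeta m ^ i)) ha using 1

theorem codeLattice_toAddSubgroup
    (C : Submodule (𝓞 (CyclotomicField m ℚ) ⧸ P) (Fin 2 → 𝓞 (CyclotomicField m ℚ) ⧸ P)) :
    (codeLattice P C).toAddSubgroup = (C.toAddSubgroup.comap
      (AddMonoidHom.compLeft (Ideal.Quotient.mk P : _ →+ _) (Fin 2))).map (integerPlaneHom m) := by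
  ext v
  rw [Submodule.mem_toAddSubgroup, mem_codeLattice]
  exact exists_congr fun a => and_congr_right fun _ => eq_comm

theorem relIndex_codeLattice_slopeLine (c : 𝓞 (CyclotomicField m ℚ) ⧸ P) :
    (codeLattice P (slopeLine c)).toAddSubgroup.relIndex (codeLattice P ⊤).toAddSubgroup =
      Nat.card (𝓞 (CyclotomicField m ℚ) ⧸ P) := by
  rw [codeLattice_toAddSubgroup, codeLattice_toAddSubgroup,
    AddSubgroup.relIndex_map_map_of_injective _ _ (integerPlaneHom_injective m),
    Submodule.top_toAddSubgroup, AddSubgroup.comap_top, AddSubgroup.relIndex_top_right]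
  let g : (Fin 2 → 𝓞 (CyclotomicField m ℚ)) →+ 𝓞 (CyclotomicField m ℚ) ⧸ P :=
    { toFun a := Ideal.Quotient.mk P (a 1) - c * Ideal.Quotient.mk P (a 0)
      map_zero' := by simp
      map_add' a b := by
        simp only [Pi.add_apply, map_add]
        ring }
  have hg : Function.Surjective g := fun y => by
    obtain ⟨x, rfl⟩ := Ideal.Quotient.mk_surjective y
    exact ⟨![0, x], by simp [g]⟩
  have hker : (slopeLine c).toAddSubgroup.comap
      (AddMonoidHom.compLeft (Ideal.Quotient.mk P : _ →+ _) (Fin 2)) = g.ker := by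
    ext a
    rw [AddSubgroup.mem_comap, Submodule.mem_toAddSubgroup, mem_slopeLine, AddMonoidHom.mem_ker]
    exact sub_eq_zero.symm
  rw [hker, AddSubgroup.index_ker, AddMonoidHom.range_eq_top.2 hg]
  exact Nat.card_congr AddSubgroup.topEquiv.toEquiv

theorem pairwise_le_norm_codeLattice_slopeLine [P.IsPrime] :
    Pairwise fun c c' : 𝓞 (CyclotomicField m ℚ) ⧸ P =>
      ∀ v ∈ codeLattice P (slopeLine c) ⊓ codeLattice P (slopeLine c'), v ≠ 0 →
        √m.totient * (Nat.card (𝓞 (CyclotomicField m ℚ) ⧸ P) : ℝ) ^ (1 / (m.totient : ℝ)) ≤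
          ‖v‖ := by
  intro c c' hcc' v hv hv0
  rw [codeLattice_inf, slopeLine_inf_slopeLine hcc'] at hv
  refine le_of_pow_le_pow_left₀ two_ne_zero (norm_nonneg v) (le_of_eq_of_le ?_
    (totient_mul_rpow_le_norm_sq_of_mem_codeLattice_bot hv hv0))
  rw [mul_pow, Real.sq_sqrt (Nat.cast_nonneg _), ← Real.rpow_mul_natCast (Nat.cast_nonneg _)]
  norm_num [div_eq_inv_mul]

theorem four_mul_mul_sqrt_le {d Q ε : ℝ} (hd : 0 ≤ d) (hQ : 0 ≤ Q) (hε : 0 < ε)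
    (h : 8 * d ^ 3 / ε ^ 2 ≤ Q) : 4 * d * √(d ^ 2 / 2) ≤ ε * (√Q * √d) := by
  refine le_of_pow_le_pow_left₀ two_ne_zero (by positivity) ?_
  rw [div_le_iff₀ (by positivity)] at h
  calc (4 * d * √(d ^ 2 / 2)) ^ 2 = 8 * d ^ 3 * d := by
        rw [mul_pow, Real.sq_sqrt (by positivity)]
        ring
    _ ≤ Q * ε ^ 2 * d := by gcongr
    _ = (ε * (√Q * √d)) ^ 2 := by
        rw [mul_pow, mul_pow, Real.sq_sqrt hQ, Real.sq_sqrt hd]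
        ring

theorem mul_pow_mul_sqrt_pow_le {d : ℕ} (hd : d ≠ 0) {a Q : ℝ} (ha : 1 ≤ a) (hQ : 0 ≤ Q)
    (h : (d : ℝ) ^ 2 * a ≤ Q) :
    a * Q ^ d * √((d : ℝ) ^ 2 / 2) ^ (2 * d) ≤ (√d * Q) ^ (2 * d) := by
  have hd1 : (1 : ℝ) ≤ d := Nat.one_le_cast.2 (Nat.one_le_iff_ne_zero.2 hd)
  rw [pow_mul, pow_mul, mul_pow √_, Real.sq_sqrt (by positivity), Real.sq_sqrt (by positivity)]
  calc a * Q ^ d * ((d : ℝ) ^ 2 / 2) ^ d ≤ a ^ d * Q ^ d * ((d : ℝ) ^ 2 / 2) ^ d := by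
        gcongr
        exact le_self_pow₀ ha hd
    _ = (Q * (d ^ 2 * a / 2)) ^ d := by
        rw [← mul_pow, ← mul_pow]
        ring
    _ ≤ (d * Q ^ 2) ^ d := by
        refine pow_le_pow_left₀ (by positivity) ?_ d
        nlinarith [mul_le_mul_of_nonneg_left h hQ, mul_le_mul_of_nonneg_right hd1 (sq_nonneg Q)]

theorem exists_mem_lineLatticeFamily_latticeDensity_ge [P.IsPrime] (hP : P ≠ ⊥) {ε : ℝ}
    (hε : 0 < ε) (hm : 1 ≤ (1 - ε) * m)
    (hcube : 8 * (m.totient : ℝ) ^ 3 / ε ^ 2 ≤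
      (Nat.card (𝓞 (CyclotomicField m ℚ) ⧸ P) : ℝ) ^ (1 / (m.totient : ℝ)))
    (hsq : (m.totient : ℝ) ^ 2 * m ≤
      (Nat.card (𝓞 (CyclotomicField m ℚ) ⧸ P) : ℝ) ^ (1 / (m.totient : ℝ))) :
    ∃ L ∈ lineLatticeFamily P, IsEuclideanLattice L ∧
      (1 - ε) * m / 2 ^ (2 * m.totient) ≤ latticeDensity L := by
  have : Finite (𝓞 (CyclotomicField m ℚ) ⧸ P) := Ideal.finiteQuotientOfFreeOfNeBot P hP
  let _ : Fintype (𝓞 (CyclotomicField m ℚ) ⧸ P) := Fintype.ofFinite _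
  have := fun C => isZLattice_codeLattice hP C
  have hn := finrank_cyclotomicPlane m
  set d := m.totient
  set Q := (Nat.card (𝓞 (CyclotomicField m ℚ) ⧸ P) : ℝ) ^ (1 / (d : ℝ)) with hQ
  have hd : d ≠ 0 := (Nat.totient_pos.2 (NeZero.pos m)).ne'
  have hQ0 : 0 ≤ Q := by positivity
  have hQd : Q ^ d = Fintype.card (𝓞 (CyclotomicField m ℚ) ⧸ P) := by
    rw [hQ, one_div, Real.rpow_inv_natCast_pow (Nat.cast_nonneg _) hd, Nat.card_eq_fintype_card]
  have : Nontrivial (CyclotomicPlane m) :=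
    Module.nontrivial_of_finrank_pos (R := ℝ) (by rw [hn]; positivity)
  have hτμ := four_mul_mul_sqrt_le d.cast_nonneg hQ0 hε hcube
  have hτR := mul_pow_mul_sqrt_pow_le hd (Nat.one_le_cast.2 (NeZero.pos m)) hQ0 hsq
  obtain ⟨c, hc⟩ := exists_latticeDensity_ge (codeLattice P ⊤)
    (fun c => codeLattice P (slopeLine c)) (fun c => codeLattice_mono le_top)
    (fun c => by rw [relIndex_codeLattice_slopeLine, Nat.card_eq_fintype_card])
    (fun c v => exists_finset_card_eq_of_mem_codeLattice) (Real.sqrt_nonneg d)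
    (fun v hv hv0 => Real.sqrt_le_iff.2
      ⟨norm_nonneg v, totient_le_norm_sq_of_mem_codeLattice hv hv0⟩)
    (fun z => (exists_mem_codeLattice_top_norm_sub_sq_le P z).imp
      fun x hx => ⟨hx.1, Real.le_sqrt_of_sq_le hx.2⟩)
    (by positivity) pairwise_le_norm_codeLattice_slopeLine (Real.sqrt_nonneg Q)
    (by rw [hn, pow_mul, Real.sq_sqrt hQ0, hQd]) hε hm
    (by rw [hn]; push_cast; linarith) (by rwa [hn, ← hQd])
  rw [hn] at hc
  exact ⟨_, ⟨_, finrank_slopeLine c, rfl⟩, ⟨inferInstance, IsZLattice.span_top⟩, hc⟩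

end CyclotomicLattices

section AdmissibleChoices

theorem IsPrimeAwayFromConductor.ne_bot {m : ℕ} [NeZero m]
    {P : Ideal (𝓞 (CyclotomicField m ℚ))} (hP : IsPrimeAwayFromConductor P) : P ≠ ⊥ := by
  obtain ⟨-, p, hp, -, hpP⟩ := hP
  exact P.ne_bot_iff.2 ⟨p, hpP, Nat.cast_ne_zero.2 hp.ne_zero⟩

variable {P : ∀ X : ℕ, Ideal (𝓞 (CyclotomicField (primorial X) ℚ))}

theorem IsAdmissibleChoice.eventually_exists_one_sub_mul_primorial_le_latticeDensity
    (hP : IsAdmissibleChoice P) {ε : ℝ} (hε0 : 0 < ε) (hε1 : ε < 1) :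
    ∀ᶠ X : ℕ in atTop, ∃ L ∈ lineLatticeFamily (P X), IsEuclideanLattice L ∧
      (1 - ε) * primorial X / 2 ^ (2 * (primorial X).totient) ≤ latticeDensity L := by
  obtain ⟨hPX, ho⟩ := hP
  have hprimorial : Tendsto primorial atTop atTop :=
    tendsto_atTop_mono (fun X => Nat.totient_le (primorial X)) tendsto_totient_primorial
  have hlarge := (tendsto_natCast_atTop_atTop.comp hprimorial).eventually_ge_atTop (1 - ε)⁻¹
  filter_upwards [hlarge, ho.bound (c := ε ^ 2 / 8) (by positivity), ho.bound one_pos]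
    with X hm hcube hsq
  have := (hPX X).1
  set d := (primorial X).totient
  set Q := (Nat.card (𝓞 (CyclotomicField (primorial X) ℚ) ⧸ P X) : ℝ) ^ (1 / (d : ℝ))
  rw [Real.norm_of_nonneg (by positivity), Real.norm_of_nonneg (by positivity)] at hcube hsq
  refine exists_mem_lineLatticeFamily_latticeDensity_ge (hPX X).ne_bot hε0
    ((inv_le_iff_one_le_mul₀' (sub_pos.2 hε1)).1 hm) ?_ (by rwa [one_mul] at hsq)
  have hd : (d : ℝ) ≤ primorial X := Nat.cast_le.2 (Nat.totient_le _)
  calc 8 * (d : ℝ) ^ 3 / ε ^ 2 = 8 / ε ^ 2 * (d ^ 2 * d) := by ring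
    _ ≤ 8 / ε ^ 2 * (d ^ 2 * primorial X) := by gcongr
    _ ≤ 8 / ε ^ 2 * (ε ^ 2 / 8 * Q) := by gcongr
    _ = Q := by field_simp

/-- The family `𝓛_𝓒` attached to `𝔓` contains a lattice of density at least
`c * n * log log n / 2 ^ n`, where `n = 2 φ(m)`: the property `HasDenseLineLattice` with an
arbitrary constant `c` in place of `0.89`. -/
def HasLineLatticeDensityGe {m : ℕ} [NeZero m] (c : ℝ) (P : Ideal (𝓞 (CyclotomicField m ℚ))) :
    Prop :=
  ∃ L ∈ lineLatticeFamily P, IsEuclideanLattice L ∧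
    c * ((2 * m.totient : ℕ) : ℝ) * Real.log (Real.log ((2 * m.totient : ℕ) : ℝ)) /
      2 ^ (2 * m.totient) ≤ latticeDensity L

theorem IsAdmissibleChoice.eventually_hasLineLatticeDensityGe (hP : IsAdmissibleChoice P) {c : ℝ}
    (hc : c < Real.exp Real.eulerMascheroniConstant / 2) :
    ∀ᶠ X in atTop, HasLineLatticeDensityGe c (P X) := by
  obtain ⟨a, hca, ha⟩ := exists_between (max_lt (by linarith : 2 * c < _) (Real.exp_pos _))
  obtain ⟨b, hab, hb⟩ := exists_between ha
  have ha0 : 0 < a := (le_max_right _ _).trans_lt hca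
  have hb0 : 0 < b := ha0.trans hab
  filter_upwards [eventually_log_log_two_mul_totient_primorial_nonneg,
    eventually_mul_log_log_mul_totient_primorial_le hb,
    hP.eventually_exists_one_sub_mul_primorial_le_latticeDensity
      (sub_pos.2 ((div_lt_one hb0).2 hab)) (sub_lt_self 1 (div_pos ha0 hb0))] with X hlog hmertens
  refine fun ⟨L, hL, hlattice, hdensity⟩ => ⟨L, hL, hlattice, hdensity.trans' ?_⟩
  refine div_le_div_of_nonneg_right ?_ (by positivity)
  set l := Real.log (Real.log ((2 * (primorial X).totient : ℕ) : ℝ))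
  calc c * ((2 * (primorial X).totient : ℕ) : ℝ) * l = 2 * c * (l * (primorial X).totient) := by
        push_cast
        ring
    _ ≤ a * (l * (primorial X).totient) := by
        gcongr
        exact (le_max_left _ _).trans hca.le
    _ = a / b * (b * l * (primorial X).totient) := by field_simp
    _ ≤ a / b * primorial X := by gcongr
    _ = (1 - (1 - a / b)) * primorial X := by rw [sub_sub_cancel]

theorem exists_isPrime_le_card_quotient (K : Type*) [Field K] [NumberField K] {p : ℕ}
    (hp : p.Prime) : ∃ P : Ideal (𝓞 K), P.IsPrime ∧ (p : 𝓞 K) ∈ P ∧ p ≤ Nat.card (𝓞 K ⧸ P) := by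
  have : (Ideal.span {(p : ℤ)}).IsPrime :=
    (Ideal.span_singleton_prime (Int.natCast_ne_zero.2 hp.ne_zero)).2 (Nat.prime_iff_prime_int.1 hp)
  obtain ⟨⟨P, hP, _⟩⟩ := (Ideal.span {(p : ℤ)}).nonempty_primesOver (S := 𝓞 K)
  refine ⟨P, hP, ?_, ?_⟩
  · simpa using (P.mem_of_liesOver (Ideal.span {(p : ℤ)}) p).1 (Ideal.mem_span_singleton_self _)
  · rw [← Submodule.cardQuot_apply, ← Ideal.absNorm_apply,
      Ideal.absNorm_eq_pow_inertiaDeg' P hp]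
    exact Nat.le_self_pow (Ideal.inertiaDeg'_pos' _ P).ne' p

theorem exists_isPrimeAwayFromConductor_le_card_quotient (m : ℕ) [NeZero m] (N : ℕ) :
    ∃ P : Ideal (𝓞 (CyclotomicField m ℚ)),
      IsPrimeAwayFromConductor P ∧ N ≤ Nat.card (𝓞 (CyclotomicField m ℚ) ⧸ P) := by
  obtain ⟨p, hle, hp⟩ := Nat.exists_infinite_primes (max (m + 1) N)
  obtain ⟨P, hP, hpP, hcard⟩ := exists_isPrime_le_card_quotient (CyclotomicField m ℚ) hp
  have hpm : ¬ p ∣ m := Nat.not_dvd_of_pos_of_lt (NeZero.pos m) ((le_max_left _ _).trans hle)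
  exact ⟨P, ⟨hP, p, hp, hpm, hpP⟩, (le_max_right _ _).trans (hle.trans hcard)⟩

theorem exists_isAdmissibleChoice :
    ∃ P : ∀ X : ℕ, Ideal (𝓞 (CyclotomicField (primorial X) ℚ)), IsAdmissibleChoice P := by
  choose P hP hcard using fun X => exists_isPrimeAwayFromConductor_le_card_quotient (primorial X)
    (((primorial X).totient ^ 2 * primorial X * X) ^ (primorial X).totient)
  refine ⟨P, hP, isLittleO_iff.2 fun c hc => ?_⟩
  filter_upwards [tendsto_natCast_atTop_atTop.eventually_ge_atTop c⁻¹] with X hX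
  set d := (primorial X).totient
  have hd : d ≠ 0 := (Nat.totient_pos.2 (primorial_pos X)).ne'
  rw [Real.norm_of_nonneg (by positivity), Real.norm_of_nonneg (by positivity)]
  have hroot : (d : ℝ) ^ 2 * primorial X * X ≤
      (Nat.card (𝓞 (CyclotomicField (primorial X) ℚ) ⧸ P X) : ℝ) ^ (1 / (d : ℝ)) := by
    rw [one_div, Real.le_rpow_inv_iff_of_pos (by positivity) (by positivity) (by positivity),
      Real.rpow_natCast]
    exact_mod_cast hcard X
  calc (d : ℝ) ^ 2 * primorial X ≤ (d : ℝ) ^ 2 * primorial X * (c * X) :=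
        le_mul_of_one_le_right (by positivity) ((inv_le_iff_one_le_mul₀' hc).1 hX)
    _ = c * ((d : ℝ) ^ 2 * primorial X * X) := by ring
    _ ≤ _ := mul_le_mul_of_nonneg_left hroot hc.le

end AdmissibleChoices

theorem mainTheorem3_general {c : ℝ} (hc : c < Real.exp Real.eulerMascheroniConstant / 2) :
    (∃ P : ∀ X : ℕ, Ideal (𝓞 (CyclotomicField (primorial X) ℚ)), IsAdmissibleChoice P) ∧
    ∀ P : ∀ X : ℕ, Ideal (𝓞 (CyclotomicField (primorial X) ℚ)), IsAdmissibleChoice P →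
      (∀ᶠ X : ℕ in atTop, HasLineLatticeDensityGe c (P X)) ∧
      {n : ℕ | ∃ X : ℕ, n = 2 * (primorial X).totient ∧
        HasLineLatticeDensityGe c (P X)}.Infinite := by
  refine ⟨exists_isAdmissibleChoice, fun P hP => ?_⟩
  have hdense := hP.eventually_hasLineLatticeDensityGe hc
  refine ⟨hdense, Set.infinite_of_forall_exists_gt fun N => ?_⟩
  obtain ⟨X, hX, hN⟩ := (hdense.and (tendsto_totient_primorial.eventually_gt_atTop N)).exists
  exact ⟨2 * (primorial X).totient, ⟨X, rfl, hX⟩, by omega⟩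

theorem mainTheorem3 :
    (∃ P : ∀ X : ℕ, Ideal (𝓞 (CyclotomicField (primorial X) ℚ)), IsAdmissibleChoice P) ∧
    ∀ P : ∀ X : ℕ, Ideal (𝓞 (CyclotomicField (primorial X) ℚ)), IsAdmissibleChoice P →
      (∀ᶠ X : ℕ in atTop, HasDenseLineLattice (P X)) ∧
      {n : ℕ | ∃ X : ℕ, n = 2 * (primorial X).totient ∧ HasDenseLineLattice (P X)}.Infinite :=
  mainTheorem3_general lt_exp_eulerMascheroniConstant_div_two
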